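/- **Setting.** Let $0<R<R'$, let $d\ge 2$ be an integer, and let $a, a_0,\dots,a_d$ be holomorphic on $D(0,R')^2$. Let $\mathcal S\subset\mathbb N$ be finite, $S\ge1$ an integer with $S>k$ for all $k\in\mathcal S$. For $m=1,2,3$ and $k\in\mathcal S$ let $$b_{m,k}(t,z,u_0,w)=\sum_{\alpha\ge0}b_{m,k,\alpha}(t,z,u_0)\frac{w^\alpha}{\alpha!}$$ be holomorphic on $D(0,R')^2\times\mathbb C\times D(0,\bar w)$ for some $\bar w>0$, and polynomial in $u_0$ of degree at most $d_{m,k}$. Let $\sigma,\bar V_0,\bar V_1,\bar\delta,\nu>0$ and $b>1$ be real numbers, with $R+\bar V_0<R'$, $R+\bar V_1<R'$ and $\nu>1/(R'-R-\bar V_1)$. Write $I(\alpha)=\{0,\dots,\alpha\}$, $r_b(\alpha)=\sum_{n=0}^{\alpha}(n+1)^{-b}$ and $\bar U_h=\bar\delta/(h^b+1)$. Put $$A_j=\sum_{l_1+l_2=j}\frac{\partial_{v_1}^{l_1}a(v_0,v_1)}{l_1!\,\nu^{l_1}}(l_2+1)\nu u_{l_2+1}+\sum_{p=0}^d\ \sum_{j_0+\dots+j_p=j}\frac{\partial_{v_1}^{j_0}a_p(v_0,v_1)}{j_0!\,\nu^{j_0}}\prod_{l=1}^pu_{j_l},\qquad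 B_j=(j+1)\nu u_{j+1}.$$ For $\rho>1$ and a holomorphic function $f$ of $v_0,v_1,(u_h)_{h\in I(\alpha)}$, its majorant series at level $\alpha$ is $$\sum_{n_0,n_1,l_h\ge0}\Big(\sup_{|v_0|,|v_1|<R,\ |u_h|<\rho}\big|\partial_{v_0}^{n_0}\partial_{v_1}^{n_1}\textstyle\prod_{h\in I(\alpha)}\partial_{u_h}^{l_h}f\big|\Big)\frac{V_0^{n_0}}{n_0!}\frac{V_1^{n_1}}{n_1!}\prod_{h\in I(\alpha)}\frac{U_h^{l_h}}{l_h!}.$$ Let $B_{m,k}(V_0,V_1,U_0,W)=\sum_\alpha B_{m,k,\alpha}W^\alpha/\alpha!$, where $B_{m,k,\alpha}$ is the majorant series of $b_{m,k,\alpha}$ at level $0$, and for $j\in I(\alpha)$ let $\mathbf A_{j,\alpha+1}$, $\mathbf B_{j,\alpha+1}$ be the majorant series of $A_j$, $B_j$ at level $\alpha+1$. For a formal series $\Psi=\sum_{\alpha\ge0}\Psi_\alpha W^\alpha/\alpha!$ with $\Psi_\alpha\in\mathbb C[[V_0,V_1,(U_h)_{h\in I(\alpha)}]]$ put $$\mathbb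 D_{\mathbf A}\Psi=\sum_{\alpha\ge0}\Big(\sum_{j\in I(\alpha)}\mathbf A_{j,\alpha+1}\,\partial_{U_j}\Psi_\alpha\Big)\frac{W^\alpha}{\alpha!},\qquad \mathbb D_{\mathbf B}\Psi=\sum_{\alpha\ge0}\Big(\sum_{j\in I(\alpha)}\mathbf B_{j,\alpha+1}\,\partial_{U_j}\Psi_\alpha\Big)\frac{W^\alpha}{\alpha!},$$ and let $\partial_W^{-1}=\int_0^W$. For $\bar W>0$, let $G_{(\rho,\bar W)}=G_{(\rho,\bar V_0,\bar V_1,(\bar U_h)_{h\ge0},\bar W)}$ be the Banach space of those $\Psi$, with $\Psi_\alpha=\sum\psi_{\alpha,n_0,n_1,(l_h)}\frac{V_0^{n_0}}{n_0!}\frac{V_1^{n_1}}{n_1!}\prod_{h\in I(\alpha)}\frac{U_h^{l_h}}{l_h!}$, for which the following series converges: $$\|\Psi\|_{(\rho,\bar W)}=\sum_{\alpha\ge0}\Big(\sum_{n_0,n_1,l_h\ge0}\frac{|\psi_{\alpha,n_0,n_1,(l_h)}|}{\exp(\sigma r_b(\alpha)\rho)}\,\frac{\bar V_0^{n_0}\bar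 V_1^{n_1}\prod_{h\in I(\alpha)}\bar U_h^{l_h}}{(n_0+n_1+\sum_{h\in I(\alpha)}l_h+\alpha)!}\Big)\bar W^\alpha .$$ **Proposition.** Assume that for all $k\in\mathcal S$ $$S\ge k+1+\max\big(b(d_{1,k}+2)+3,\ d+1+b(d+d_{1,k}+1)\big),\qquad S\ge k+3+b(2+d_{2,k}),$$ $$S\ge k+1+b\max(d_{1,k},d_{2,k}),\qquad S\ge k+b\,d_{3,k}.$$ Then there exists $\bar W>0$, independent of $\rho>1$, such that for every $\rho>1$ and every $\tilde I\in G_{(\rho,\bar W)}$ the functional equation $$\Psi=\sum_{k\in\mathcal S}\Big(B_{1,k}\,\partial_W^{-S+k}\partial_{V_0}\Psi+B_{1,k}\,\partial_W^{-S+k}\mathbb D_{\mathbf A}\Psi\Big)+\sum_{k\in\mathcal S}\Big(B_{2,k}\,\partial_W^{-S+k}\partial_{V_1}\Psi+B_{2,k}\,\partial_W^{-S+k}\mathbb D_{\mathbf B}\Psi\Big)+\sum_{k\in\mathcal S}B_{3,k}\,\partial_W^{-S+k}\Psi+\tilde I$$ has a unique solution $\Psi\in G_{(\rho,\bar W)}$,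 and moreover $\|\Psi\|_{(\rho,\bar W)}\le2\|\tilde I\|_{(\rho,\bar W)}$. -/

import Mathlib

open scoped Nat

noncomputable section

namespace InfVar

/-- The variables `V₀`, `V₁` and `U_h`, `h ≥ 0`. The same index type is used for the arguments
`v₀`, `v₁`, `u_h` of the holomorphic functions. -/
inductive Var
  | V0 : Var
  | V1 : Var
  | U : ℕ → Var
  deriving DecidableEq

open Var

/-- The variables `V₀, V₁, (U_h)_{h ∈ I(α)}` with `I(α) = {0, …, α}`. -/
def varsUpTo (α : ℕ) : Set Var := {V0, V1} ∪ U '' Set.Iic α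

/-! ### Majorant series of a holomorphic function -/

/-- Partial derivative in the variable `i` of a function of the variables `v₀, v₁, (u_h)`. -/
def partialD (i : Var) (f : (Var → ℂ) → ℂ) : (Var → ℂ) → ℂ :=
  fun x => deriv (fun s : ℂ => f (Function.update x i s)) (x i)

/-- `∏_{h < N} ∂_{u_h}^{l_h} f`. -/
def uDeriv (l : ℕ → ℕ) : ℕ → ((Var → ℂ) → ℂ) → ((Var → ℂ) → ℂ)
  | 0, f => f
  | N + 1, f => uDeriv l N ((partialD (U N))^[l N] f)

/-- `∂_{v₀}^{n₀} ∂_{v₁}^{n₁} ∏_{h ∈ I(α)} ∂_{u_h}^{l_h} f`, where `n` is the multi-index with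
components `n₀ = n V0`, `n₁ = n V1`, `l_h = n (U h)`. -/
def mixedD (α : ℕ) (n : Var →₀ ℕ) (f : (Var → ℂ) → ℂ) : (Var → ℂ) → ℂ :=
  (partialD V0)^[n V0] ((partialD V1)^[n V1] (uDeriv (fun h => n (U h)) (α + 1) f))

/-- The polydisc `|v₀| < R`, `|v₁| < R`, `|u_h| < ρ` for `h ∈ I(α)`. -/
def polydisc (R ρ : ℝ) (α : ℕ) : Set (Var → ℂ) :=
  {x | ‖x V0‖ < R ∧ ‖x V1‖ < R ∧ ∀ h ≤ α, ‖x (U h)‖ < ρ}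

/-- The supremum over the polydisc of the modulus of a mixed derivative of `f`. -/
def supD (R ρ : ℝ) (α : ℕ) (n : Var →₀ ℕ) (f : (Var → ℂ) → ℂ) : ℝ :=
  sSup ((fun x => ‖mixedD α n f x‖) '' polydisc R ρ α)

/-- The factorial `n₀! n₁! ∏_h l_h!` of a multi-index. -/
def multiFactorial (n : Var →₀ ℕ) : ℕ := n.prod fun _ m => (m !)

open Classical in
/-- The formal series in `V₀, V₁, (U_h)_{h ∈ I(α)}`
`∑ (sup |∂^n f|) V₀^{n₀} / n₀! · V₁^{n₁} / n₁! · ∏_{h ∈ I(α)} U_h^{l_h} / l_h!`. -/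
def majorantSeries (R ρ : ℝ) (α : ℕ) (f : (Var → ℂ) → ℂ) : MvPowerSeries Var ℂ :=
  fun n => if (n.support : Set Var) ⊆ varsUpTo α then
    ((supD R ρ α n f / multiFactorial n : ℝ) : ℂ) else 0

/-! ### The coefficients of the functional equation -/

/-- For `b(t,z,u₀,w) = ∑_α b_α(t,z,u₀) w^α / α!`, the coefficient `b_α`. -/
def wCoeff (b : ℂ → ℂ → ℂ → ℂ → ℂ) (α : ℕ) : (Var → ℂ) → ℂ :=
  fun x => iteratedDeriv α (fun w => b (x V0) (x V1) (x (U 0)) w) 0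

/-- The series `B(V₀,V₁,U₀,W) = ∑_α (∑ b_{α,n₀,n₁,l₀} V₀^{n₀}/n₀! V₁^{n₁}/n₁! U₀^{l₀}/l₀!) W^α/α!`
attached to `b(t,z,u₀,w)`. -/
def bigB (R ρ : ℝ) (b : ℂ → ℂ → ℂ → ℂ → ℂ) : PowerSeries (MvPowerSeries Var ℂ) :=
  PowerSeries.mk fun α => ((α ! : ℂ)⁻¹) • majorantSeries R ρ 0 (wCoeff b α)

/-- The function
`A_j = ∑_{l₁+l₂=j} ∂_{v₁}^{l₁} a(v₀,v₁) / (l₁! ν^{l₁}) (l₂+1) ν u_{l₂+1}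
  + ∑_{p=0}^d ∑_{j₀+…+j_p=j} ∂_{v₁}^{j₀} a_p(v₀,v₁) / (j₀! ν^{j₀}) ∏_{l=1}^p u_{j_l}`. -/
def funA (ν : ℝ) (d : ℕ) (a : ℂ → ℂ → ℂ) (ap : ℕ → ℂ → ℂ → ℂ) (j : ℕ) : (Var → ℂ) → ℂ :=
  fun x =>
    (∑ l ∈ Finset.HasAntidiagonal.antidiagonal j,
      iteratedDeriv l.1 (a (x V0)) (x V1) / ((l.1 ! : ℂ) * (ν : ℂ) ^ l.1)
        * ((l.2 : ℂ) + 1) * (ν : ℂ) * x (U (l.2 + 1)))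
    + ∑ p ∈ Finset.range (d + 1), ∑ t ∈ Finset.Nat.antidiagonalTuple (p + 1) j,
      iteratedDeriv (t 0) (ap p (x V0)) (x V1) / (((t 0) ! : ℂ) * (ν : ℂ) ^ (t 0))
        * ∏ l : Fin p, x (U (t l.succ))

/-- The function `B_j = (j+1) ν u_{j+1}`. -/
def funB (ν : ℝ) (j : ℕ) : (Var → ℂ) → ℂ :=
  fun x => ((j : ℂ) + 1) * (ν : ℂ) * x (U (j + 1))

/-! ### Formal series in infinitely many variables and operators on them

An element of `PowerSeries (MvPowerSeries Var ℂ)` is a formal series in `W` whose coefficients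
are formal series in `V₀, V₁, (U_h)_{h ≥ 0}`. In the notation `Ψ = ∑_α Ψ_α W^α / α!`, one has
`Ψ_α = α! · coeff α Ψ`. -/

/-- `Ψ_α` in `Ψ = ∑_α Ψ_α W^α / α!`. -/
def comp (α : ℕ) (Ψ : PowerSeries (MvPowerSeries Var ℂ)) : MvPowerSeries Var ℂ :=
  (α ! : ℂ) • PowerSeries.coeff α Ψ

/-- The space of formal series `∑_α Ψ_α W^α / α!` where `Ψ_α` only involves the variables
`V₀, V₁, (U_h)_{h ∈ I(α)}`. -/
def formalG : Set (PowerSeries (MvPowerSeries Var ℂ)) :=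
  {Ψ | ∀ (α : ℕ) (n : Var →₀ ℕ), MvPowerSeries.coeff n (comp α Ψ) ≠ 0 →
    (n.support : Set Var) ⊆ varsUpTo α}

/-- The partial derivative `∂_{V₀}`, `∂_{V₁}` or `∂_{U_h}`, acting on each coefficient in `W`. -/
def dVar (i : Var) (Ψ : PowerSeries (MvPowerSeries Var ℂ)) : PowerSeries (MvPowerSeries Var ℂ) :=
  PowerSeries.mk fun α => MvPowerSeries.pderiv ℂ i (PowerSeries.coeff α Ψ)

/-- Integration `∂_W^{-1} = ∫_0^W`. -/
def intW (Ψ : PowerSeries (MvPowerSeries Var ℂ)) : PowerSeries (MvPowerSeries Var ℂ) :=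
  PowerSeries.mk fun
    | 0 => 0
    | n + 1 => (((n : ℂ) + 1)⁻¹) • PowerSeries.coeff n Ψ

/-- For functions `F_j`, the operator
`Ψ ↦ ∑_α (∑_{j ∈ I(α)} 𝐅_{j,α+1} ∂_{U_j} Ψ_α) W^α / α!`, where `𝐅_{j,α+1}` is the
majorant series of `F_j` in the variables `V₀, V₁, (U_h)_{h ∈ I(α+1)}`. -/
def opD (R ρ : ℝ) (F : ℕ → (Var → ℂ) → ℂ) (Ψ : PowerSeries (MvPowerSeries Var ℂ)) :
    PowerSeries (MvPowerSeries Var ℂ) :=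
  PowerSeries.mk fun α => ((α ! : ℂ)⁻¹) • ∑ j ∈ Finset.range (α + 1),
    majorantSeries R ρ (α + 1) (F j) * MvPowerSeries.pderiv ℂ (U j) (comp α Ψ)

/-! ### The Banach spaces -/

/-- `r_b(α) = ∑_{n=0}^α 1/(n+1)^b`. -/
def rb (b : ℝ) (α : ℕ) : ℝ := ∑ n ∈ Finset.range (α + 1), 1 / ((n : ℝ) + 1) ^ b

/-- The radii `V̄₀`, `V̄₁` and `Ū_h = δ̄ / (h^b + 1)`. -/
def radius (b V₀ V₁ δ : ℝ) : Var → ℝ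
  | V0 => V₀
  | V1 => V₁
  | U h => δ / ((h : ℝ) ^ b + 1)

/-- The term of multi-index `n` in the norm of
`Φ = ∑ φ_n V₀^{n₀}/n₀! V₁^{n₁}/n₁! ∏_h U_h^{l_h}/l_h!` in the space `E` of index `α`. -/
def eTerm (ρ σ b V₀ V₁ δ : ℝ) (α : ℕ) (Φ : MvPowerSeries Var ℂ) (n : Var →₀ ℕ) : ℝ :=
  ‖(multiFactorial n : ℂ) * MvPowerSeries.coeff n Φ‖ / Real.exp (σ * rb b α * ρ)
    * ((n.prod fun i m => radius b V₀ V₁ δ i ^ m) / ((n.degree + α)! : ℝ))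

/-- The norm of the space `E` of index `α`. -/
def eNorm (ρ σ b V₀ V₁ δ : ℝ) (α : ℕ) (Φ : MvPowerSeries Var ℂ) : ℝ :=
  ∑' n : Var →₀ ℕ, eTerm ρ σ b V₀ V₁ δ α Φ n

/-- The norm of the space `G`. -/
def gNorm (ρ σ b V₀ V₁ δ W : ℝ) (Ψ : PowerSeries (MvPowerSeries Var ℂ)) : ℝ :=
  ∑' α : ℕ, eNorm ρ σ b V₀ V₁ δ α (comp α Ψ) * W ^ α

/-- The space `G` of parameters `ρ, V̄₀, V̄₁, (Ū_h)_{h ≥ 0}, W̄`. -/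
def spaceG (ρ σ b V₀ V₁ δ W : ℝ) : Set (PowerSeries (MvPowerSeries Var ℂ)) :=
  {Ψ | Ψ ∈ formalG ∧
    (∀ α : ℕ, Summable (eTerm ρ σ b V₀ V₁ δ α (comp α Ψ))) ∧
    Summable fun α : ℕ => eNorm ρ σ b V₀ V₁ δ α (comp α Ψ) * W ^ α}

end InfVar

end

noncomputable section
namespace InfVar

open Var Finset
open scoped ENNReal

/-! ### Weighted `ℓ¹` norms of formal series -/

/-! The equation has the form `Ψ = T Ψ + I` with `T` additive. Since `k < S`, every term of `T`
contains an integration in `W`, so `T` raises the order in `W`. Each `W`-coefficient of the Neumann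
series `∑ T^k I` is thus a finite sum, and the series solves the equation formally, without any
appeal to completeness (`exists_eq_add_of_order_raising`). What remains is `‖T‖ ≤ 1/2`. It follows
from `‖T‖ ≤ C W` with `C` independent of `ρ` (`SmallOp`), which also makes `W` independent of `ρ`.

The bound on `T` balances gains against losses in the component of index `α`. With `s = S - k`, the
`s` integrations move index `α` to `α + s`. The factorials in the norm then yield `(α+1)^(-s)`, or
`(α+1)^(-(s-1))` if a derivative uses up one factor, and the increase of `r_b` yields
`exp(-σρ/(α+2)^b)` (`wt_le_gain`, `wt_pderiv_le_gain`). The losses are `ρ^D` from `B_{m,k}`, powers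
of `α+1` and of `ρ` from the majorants of `A_j` or `B_j`, a factor `α+1` from the sum over `j`, and
`(α+1)^b` from `1/Ū_j`. The exponential absorbs `ρ^Q` at the price of `(α+1)^(bQ)`
(`rpow_mul_exp_neg_le`), and the lower bounds on `S` say that the total power of `α+1` is paid for
by the integrations.

The majorants are estimated through one model: finite sums of monomials in the `u_h` with
coefficients holomorphic in `v₀, v₁`. Cauchy's inequalities dominate such a majorant by geometric
series in `V₀, V₁` times binomial expansions in the `U_h` (`wNorm_majorantSeries_le`); the condition
on `ν` enters in `derivBound_iteratedDeriv`.

Norms are computed in `ℝ≥0∞`, where sums may be interchanged freely; `mem_spaceG_iff` and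
`ofReal_gNorm` translate back to real norms. -/

/-- The weighted `ℓ¹` norm of the coefficients of a formal series in `V₀, V₁, (U_h)`. -/
def wNorm (ω : (Var →₀ ℕ) → ℝ) (χ : MvPowerSeries Var ℂ) : ℝ≥0∞ :=
  ∑' n, ‖MvPowerSeries.coeff n χ‖ₑ * ENNReal.ofReal (ω n)

/-- The weighted `ℓ¹` norm of the coefficients of a formal series in `W, V₀, V₁, (U_h)`. -/
def wNormW (ω : ℕ → (Var →₀ ℕ) → ℝ) (Ψ : PowerSeries (MvPowerSeries Var ℂ)) : ℝ≥0∞ :=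
  ∑' α, wNorm (ω α) (PowerSeries.coeff α Ψ)

/-- The monomial `∏_i r_i ^ n_i`. -/
def monom (r : Var → ℝ) (n : Var →₀ ℕ) : ℝ := n.prod fun i m => r i ^ m

theorem monom_add (r : Var → ℝ) (p q : Var →₀ ℕ) : monom r (p + q) = monom r p * monom r q :=
  Finsupp.prod_add_index' (by simp) (by intros; rw [pow_add])

theorem monom_pos {r : Var → ℝ} (hr : ∀ i, 0 < r i) (n : Var →₀ ℕ) : 0 < monom r n :=
  Finset.prod_pos fun i _ => pow_pos (hr i) _

theorem monom_single (r : Var → ℝ) (i : Var) (k : ℕ) :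
    monom r (Finsupp.single i k) = r i ^ k := by
  simp [monom]

/-! ### Factorial inequalities and monotonicity of `r_b` -/

theorem multiFactorial_pos (n : Var →₀ ℕ) : 0 < multiFactorial n :=
  Finset.prod_pos fun _ _ => Nat.factorial_pos _

theorem multiFactorial_add_single (n : Var →₀ ℕ) (i : Var) :
    multiFactorial (n + Finsupp.single i 1) = (n i + 1) * multiFactorial n := by
  classical
  unfold multiFactorial
  rw [← Finsupp.mul_prod_erase' (n + Finsupp.single i 1) i _ (by simp),
    ← Finsupp.mul_prod_erase' n i _ (by simp)]
  have : (n + Finsupp.single i 1).erase i = n.erase i := by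
    ext j
    by_cases h : j = i
    · subst h; simp
    · simp [Finsupp.erase_ne h]
  rw [this]
  simp [Nat.factorial_succ, mul_assoc]

/-- The property is stable under addition of the `p`'s, so `p` may be a single unit in one variable
`i`. The left side then gains the factor `(q i + 1) / (K + 1)`, which is at most `1` because `q i ≤
q.degree ≤ K`. -/
theorem multiFactorial_add_div_le (p : Var →₀ ℕ) : ∀ (q : Var →₀ ℕ) (K : ℕ), q.degree ≤ K →
    (multiFactorial (p + q) : ℝ) / ((K + p.degree)! : ℝ) ≤ multiFactorial q / (K ! : ℝ) := by
  classical
  have trans : ∀ p₁ p₂ : Var →₀ ℕ,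
      (∀ (q : Var →₀ ℕ) (K : ℕ), q.degree ≤ K → (multiFactorial (p₁ + q) : ℝ) /
        ((K + p₁.degree)! : ℝ) ≤ multiFactorial q / (K ! : ℝ)) →
      (∀ (q : Var →₀ ℕ) (K : ℕ), q.degree ≤ K → (multiFactorial (p₂ + q) : ℝ) /
        ((K + p₂.degree)! : ℝ) ≤ multiFactorial q / (K ! : ℝ)) →
      (∀ (q : Var →₀ ℕ) (K : ℕ), q.degree ≤ K → (multiFactorial (p₁ + p₂ + q) : ℝ) /
        ((K + (p₁ + p₂).degree)! : ℝ) ≤ multiFactorial q / (K ! : ℝ)) := by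
    intro p₁ p₂ h₁ h₂ q K hq
    refine le_trans ?_ (h₂ q K hq)
    have := h₁ (p₂ + q) (K + p₂.degree) (by rw [map_add]; omega)
    rwa [← add_assoc, add_assoc K, add_comm p₂.degree, ← map_add] at this
  have one : ∀ (i : Var) (q : Var →₀ ℕ) (K : ℕ), q.degree ≤ K →
      (multiFactorial (Finsupp.single i 1 + q) : ℝ) /
        ((K + (Finsupp.single i 1).degree)! : ℝ) ≤ multiFactorial q / (K ! : ℝ) := by
    intro i q K hq
    have hi : (q i : ℝ) ≤ K := by exact_mod_cast (Finsupp.le_degree i q).trans hq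
    rw [add_comm, multiFactorial_add_single, Finsupp.degree_single, Nat.factorial_succ]
    push_cast
    rw [div_le_div_iff₀ (by positivity) (by positivity)]
    nlinarith [mul_le_mul_of_nonneg_right hi
      (show (0 : ℝ) ≤ multiFactorial q * (K ! : ℝ) by positivity)]
  induction p using Finsupp.induction_linear with
  | zero => intro q K _; simp
  | add p₁ p₂ h₁ h₂ => exact trans p₁ p₂ h₁ h₂
  | single i k =>
    induction k with
    | zero => intro q K _; simp
    | succ k ih =>
      rw [Finsupp.single_add]
      exact trans _ _ ih (one i)

theorem factorial_add_div_le (β : ℕ) {α K : ℕ} (h : α ≤ K) :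
    ((β + α)! : ℝ) / ((K + β)! : ℝ) ≤ (α ! : ℝ) / (K ! : ℝ) := by
  induction β with
  | zero => simp
  | succ β ih =>
    refine le_trans ?_ ih
    have : ((β : ℝ) + α) ≤ K + β := by exact_mod_cast (by omega : β + α ≤ K + β)
    rw [show β + 1 + α = (β + α) + 1 by ring, ← add_assoc, Nat.factorial_succ, Nat.factorial_succ]
    push_cast
    rw [div_le_div_iff₀ (by positivity) (by positivity)]
    nlinarith [mul_le_mul_of_nonneg_right this
      (show (0 : ℝ) ≤ ((β + α)! : ℝ) * ((K + β)! : ℝ) by positivity)]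

theorem rb_mono (b : ℝ) : Monotone (rb b) := by
  refine monotone_nat_of_le_succ fun n => ?_
  unfold rb
  rw [Finset.sum_range_succ _ (n + 1)]
  have : 0 ≤ 1 / (((n + 1 : ℕ) : ℝ) + 1) ^ b := by positivity
  linarith

/-- Only the first new term of the sum is kept. It is the source of the decay `exp(-σρ/(α+2)^b)`
that later absorbs the powers of `ρ`. -/
theorem rb_add_sub_rb (b : ℝ) (α s : ℕ) (hs : 1 ≤ s) :
    1 / ((α : ℝ) + 2) ^ b ≤ rb b (α + s) - rb b α := by
  have h := rb_mono b (show α + 1 ≤ α + s by omega)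
  have : rb b (α + 1) = rb b α + 1 / ((α : ℝ) + 2) ^ b := by
    unfold rb
    rw [Finset.sum_range_succ _ (α + 1)]
    push_cast
    norm_num [add_assoc]
  linarith

/-- The weight of the coefficient of index `(α, n)` in the norm of `∂_W^{-s} Ψ`. -/
def wt (σ b ρ W : ℝ) (r : Var → ℝ) (s α : ℕ) (n : Var →₀ ℕ) : ℝ :=
  (α ! : ℝ) * multiFactorial n / ((n.degree + α + s)! : ℝ) * monom r n
    * Real.exp (-(σ * rb b (α + s) * ρ)) * W ^ (α + s)

section Weights

variable {σ b ρ W : ℝ} {r : Var → ℝ}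

theorem wt_pos (hr : ∀ i, 0 < r i) (hW : 0 < W) (s α : ℕ) (n : Var →₀ ℕ) :
    0 < wt σ b ρ W r s α n := by
  have := monom_pos hr n
  have := multiFactorial_pos n
  unfold wt
  positivity

/-- This makes multiplication by a series bounded: the factor of index `(β, p)` is measured by the
plain weight `W^β r^p`. The factorial in the denominator outgrows those in the numerator, first
along `p`, then along `β`, and the exponential decreases with the index. -/
theorem wt_add_le (hr : ∀ i, 0 < r i) (hW : 0 < W) (hσ : 0 ≤ σ) (hρ : 0 ≤ ρ) (s β α : ℕ)
    (p q : Var →₀ ℕ) :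
    wt σ b ρ W r s (β + α) (p + q) ≤ W ^ β * monom r p * wt σ b ρ W r s α q := by
  have hp := monom_pos hr p
  have hq := monom_pos hr q
  have h₁ : ((β + α)! : ℝ) * multiFactorial (p + q) / (((p + q).degree + (β + α) + s)! : ℝ) ≤
      (α ! : ℝ) * multiFactorial q / ((q.degree + α + s)! : ℝ) := by
    have e₁ := factorial_add_div_le β (show α ≤ q.degree + α + s by omega)
    have e₂ := multiFactorial_add_div_le p q (q.degree + α + s + β) (by omega)
    rw [show (p + q).degree + (β + α) + s = q.degree + α + s + β + p.degree by
      rw [map_add]; ring]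
    calc _ = ((β + α)! : ℝ) * (multiFactorial (p + q) /
          ((q.degree + α + s + β + p.degree)! : ℝ)) := by rw [mul_div_assoc]
      _ ≤ ((β + α)! : ℝ) * (multiFactorial q / ((q.degree + α + s + β)! : ℝ)) := by gcongr
      _ = multiFactorial q * (((β + α)! : ℝ) / ((q.degree + α + s + β)! : ℝ)) := by ring
      _ ≤ multiFactorial q * ((α ! : ℝ) / ((q.degree + α + s)! : ℝ)) := by gcongr
      _ = _ := by ring
  have h₂ : Real.exp (-(σ * rb b (β + α + s) * ρ)) ≤ Real.exp (-(σ * rb b (α + s) * ρ)) := by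
    have := rb_mono b (show α + s ≤ β + α + s by omega)
    gcongr
  unfold wt
  rw [monom_add]
  calc _ ≤ (α ! : ℝ) * multiFactorial q / ((q.degree + α + s)! : ℝ) * (monom r p * monom r q)
      * Real.exp (-(σ * rb b (α + s) * ρ)) * W ^ (β + α + s) := by gcongr
    _ = _ := by rw [show β + α + s = β + (α + s) by ring, pow_add]; ring

end Weights

/-! ### Sums, products and derivatives in the weighted norms -/

theorem tsum_antidiagonal {A : Type*} [AddMonoid A] [HasAntidiagonal A] (g : A × A → ℝ≥0∞) :
    ∑' n, ∑ p ∈ antidiagonal n, g p = ∑' p, g p := by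
  have h : ∑' x : (n : A) × antidiagonal n, g x.2.1 = ∑' p, g p :=
    (Finset.HasAntidiagonal.sigmaAntidiagonalEquivProd (A := A)).tsum_eq g
  rw [← h, ENNReal.tsum_sigma']
  refine tsum_congr fun n => ?_
  rw [tsum_fintype, ← Finset.sum_coe_sort]

theorem wNorm_zero (ω : (Var →₀ ℕ) → ℝ) : wNorm ω 0 = 0 := by simp [wNorm]

theorem wNorm_add_le (ω : (Var →₀ ℕ) → ℝ) (χ ψ : MvPowerSeries Var ℂ) :
    wNorm ω (χ + ψ) ≤ wNorm ω χ + wNorm ω ψ := by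
  unfold wNorm
  rw [← ENNReal.tsum_add]
  refine ENNReal.tsum_le_tsum fun n => ?_
  rw [← add_mul, map_add]
  gcongr
  exact enorm_add_le _ _

theorem wNorm_sum_le {ι : Type*} (ω : (Var →₀ ℕ) → ℝ) (s : Finset ι)
    (χ : ι → MvPowerSeries Var ℂ) : wNorm ω (∑ i ∈ s, χ i) ≤ ∑ i ∈ s, wNorm ω (χ i) :=
  Finset.le_sum_of_subadditive (wNorm ω) (wNorm_zero ω).le (wNorm_add_le ω) s χ

theorem wNorm_smul (ω : (Var →₀ ℕ) → ℝ) (c : ℂ) (χ : MvPowerSeries Var ℂ) :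
    wNorm ω (c • χ) = ‖c‖ₑ * wNorm ω χ := by
  unfold wNorm
  rw [← ENNReal.tsum_mul_left]
  refine tsum_congr fun n => ?_
  simp [enorm_mul, mul_assoc]

theorem wNorm_mono_smul {ω ω' : (Var →₀ ℕ) → ℝ} {c : ℝ} (hc : 0 ≤ c)
    (h : ∀ n, ω n ≤ c * ω' n) (χ : MvPowerSeries Var ℂ) :
    wNorm ω χ ≤ ENNReal.ofReal c * wNorm ω' χ := by
  unfold wNorm
  rw [← ENNReal.tsum_mul_left]
  refine ENNReal.tsum_le_tsum fun n => ?_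
  calc _ ≤ ‖MvPowerSeries.coeff n χ‖ₑ * ENNReal.ofReal (c * ω' n) := by
        gcongr; exact h n
    _ = _ := by rw [ENNReal.ofReal_mul hc]; ring

/-- Expand the Cauchy product and reindex over pairs. Three different weights are allowed because
the multiplier is measured without factorials, unlike the series it acts on. -/
theorem wNorm_mul_le {ω u ω' : (Var →₀ ℕ) → ℝ} (hu : ∀ p, 0 ≤ u p)
    (h : ∀ p q, ω (p + q) ≤ u p * ω' q) (χ ψ : MvPowerSeries Var ℂ) :
    wNorm ω (χ * ψ) ≤ wNorm u χ * wNorm ω' ψ := by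
  classical
  unfold wNorm
  rw [← ENNReal.tsum_mul_right]
  simp_rw [← ENNReal.tsum_mul_left]
  rw [← ENNReal.tsum_prod (f := fun p q => ‖MvPowerSeries.coeff p χ‖ₑ * ENNReal.ofReal (u p)
    * (‖MvPowerSeries.coeff q ψ‖ₑ * ENNReal.ofReal (ω' q)))]
  rw [← tsum_antidiagonal]
  refine ENNReal.tsum_le_tsum fun n => ?_
  rw [MvPowerSeries.coeff_mul]
  refine (mul_le_mul_left (enorm_sum_le _ _) _).trans ?_
  rw [Finset.sum_mul]
  refine Finset.sum_le_sum fun p hp => ?_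
  rw [← mem_antidiagonal.mp hp, enorm_mul]
  calc _ ≤ ‖MvPowerSeries.coeff p.1 χ‖ₑ * ‖MvPowerSeries.coeff p.2 ψ‖ₑ *
        ENNReal.ofReal (u p.1 * ω' p.2) := by gcongr; exact h _ _
    _ = _ := by rw [ENNReal.ofReal_mul (hu _)]; ring

/-- The shift `n ↦ n + e_i` is injective, so the sum over shifted indices is bounded by the full
sum; the factor `n i + 1` comes from differentiating the monomial. -/
theorem wNorm_pderiv_le {ω ω' : (Var →₀ ℕ) → ℝ} {c : ℝ} (hc : 0 ≤ c) (i : Var)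
    (h : ∀ n, ((n i : ℝ) + 1) * ω n ≤ c * ω' (n + Finsupp.single i 1))
    (χ : MvPowerSeries Var ℂ) :
    wNorm ω (MvPowerSeries.pderiv ℂ i χ) ≤ ENNReal.ofReal c * wNorm ω' χ := by
  unfold wNorm
  refine le_trans ?_ (mul_le_mul_right (ENNReal.tsum_comp_le_tsum_of_injective
    (add_left_injective (Finsupp.single i 1))
    (fun n => ‖MvPowerSeries.coeff n χ‖ₑ * ENNReal.ofReal (ω' n))) _)
  rw [← ENNReal.tsum_mul_left]
  refine ENNReal.tsum_le_tsum fun n => ?_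
  rw [MvPowerSeries.coeff_pderiv, enorm_mul]
  have : ‖((n i : ℂ) + 1)‖ₑ = ENNReal.ofReal ((n i : ℝ) + 1) := by
    rw [← ofReal_norm]
    congr 1
    exact_mod_cast Complex.norm_natCast (n i + 1)
  rw [this, mul_assoc, ← ENNReal.ofReal_mul (by positivity), mul_left_comm,
    ← ENNReal.ofReal_mul hc]
  exact mul_le_mul_right (ENNReal.ofReal_le_ofReal (h n)) _

theorem wNormW_add_le (ω : ℕ → (Var →₀ ℕ) → ℝ) (Φ Ψ : PowerSeries (MvPowerSeries Var ℂ)) :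
    wNormW ω (Φ + Ψ) ≤ wNormW ω Φ + wNormW ω Ψ := by
  unfold wNormW
  rw [← ENNReal.tsum_add]
  refine ENNReal.tsum_le_tsum fun n => ?_
  rw [map_add]
  exact wNorm_add_le _ _ _

theorem wNormW_zero (ω : ℕ → (Var →₀ ℕ) → ℝ) : wNormW ω 0 = 0 := by
  simp [wNormW, wNorm_zero]

theorem wNormW_neg (ω : ℕ → (Var →₀ ℕ) → ℝ) (Ψ : PowerSeries (MvPowerSeries Var ℂ)) :
    wNormW ω (-Ψ) = wNormW ω Ψ := by
  simp [wNormW, wNorm]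

theorem eq_zero_of_wNormW_eq_zero {ω : ℕ → (Var →₀ ℕ) → ℝ} (hω : ∀ α n, 0 < ω α n)
    {Ψ : PowerSeries (MvPowerSeries Var ℂ)} (h : wNormW ω Ψ = 0) : Ψ = 0 := by
  ext α n
  have h₁ := ENNReal.tsum_eq_zero.mp (ENNReal.tsum_eq_zero.mp h α) n
  rcases mul_eq_zero.mp h₁ with h₂ | h₂
  · simpa using h₂
  · exact absurd (ENNReal.ofReal_eq_zero.mp h₂) (not_le.mpr (hω α n))

theorem wNormW_mul_le {ω : ℕ → (Var →₀ ℕ) → ℝ} {u : (Var →₀ ℕ) → ℝ} {W : ℝ} (hW : 0 ≤ W)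
    (hu : ∀ p, 0 ≤ u p)
    (h : ∀ β α p q, ω (β + α) (p + q) ≤ W ^ β * u p * ω α q)
    (B Ψ : PowerSeries (MvPowerSeries Var ℂ)) :
    wNormW ω (B * Ψ) ≤
      (∑' β, ENNReal.ofReal (W ^ β) * wNorm u (PowerSeries.coeff β B)) * wNormW ω Ψ := by
  unfold wNormW
  rw [← ENNReal.tsum_mul_right]
  simp_rw [← ENNReal.tsum_mul_left]
  rw [← ENNReal.tsum_prod (f := fun β α => ENNReal.ofReal (W ^ β)
    * wNorm u (PowerSeries.coeff β B) * wNorm (ω α) (PowerSeries.coeff α Ψ)),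
    ← tsum_antidiagonal]
  refine ENNReal.tsum_le_tsum fun n => ?_
  rw [PowerSeries.coeff_mul]
  refine (wNorm_sum_le _ _ _).trans (Finset.sum_le_sum fun p hp => ?_)
  rw [← mem_antidiagonal.mp hp]
  refine (wNorm_mul_le (u := fun q => W ^ p.1 * u q) (ω' := ω p.2)
    (fun q => mul_nonneg (pow_nonneg hW _) (hu _)) (h _ _) _ _).trans ?_
  gcongr
  exact wNorm_mono_smul (pow_nonneg hW _) (fun n => le_rfl) _

/-! ### The operators on formal series -/

theorem coeff_intW_iterate_lt (s : ℕ) (Ξ : PowerSeries (MvPowerSeries Var ℂ)) :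
    ∀ α < s, PowerSeries.coeff α (intW^[s] Ξ) = 0 := by
  induction s with
  | zero => simp
  | succ s ih =>
    intro α hα
    rw [Function.iterate_succ_apply', intW, PowerSeries.coeff_mk]
    rcases α with _ | α
    · rfl
    · simp [ih α (by omega)]

theorem coeff_intW_iterate_add (s : ℕ) (Ξ : PowerSeries (MvPowerSeries Var ℂ)) (α : ℕ) :
    PowerSeries.coeff (α + s) (intW^[s] Ξ) =
      ((α ! : ℂ) / ((α + s)! : ℂ)) • PowerSeries.coeff α Ξ := by
  induction s with
  | zero => simp [div_self (Nat.cast_ne_zero (R := ℂ).mpr (Nat.factorial_ne_zero α))]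
  | succ s ih =>
    rw [Function.iterate_succ_apply', intW, PowerSeries.coeff_mk]
    change (((α + s : ℕ) : ℂ) + 1)⁻¹ • PowerSeries.coeff (α + s) (intW^[s] Ξ) = _
    rw [ih, smul_smul, ← add_assoc α s 1, Nat.factorial_succ]
    congr 1
    push_cast
    field_simp

theorem tsum_eq_tsum_add_of_forall_lt {f : ℕ → ℝ≥0∞} (s : ℕ) (h : ∀ n < s, f n = 0) :
    ∑' n, f n = ∑' n, f (n + s) := by
  have h₀ : ∑ n ∈ Finset.range s, f n = 0 :=
    Finset.sum_eq_zero fun n hn => h n (Finset.mem_range.mp hn)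
  rw [← (ENNReal.summable (f := fun n => f (n + s))).sum_add_tsum_nat_add', h₀, zero_add]

/-- The factor `α!/(α+s)!` produced by integration replaces `(α+s)!` by `α!` in the weight.
Integrations are thereby moved into the parameter `s` of `wt`, with equality. -/
theorem wNormW_intW_iterate (σ b ρ W : ℝ) (r : Var → ℝ) (s : ℕ)
    (Ξ : PowerSeries (MvPowerSeries Var ℂ)) :
    wNormW (wt σ b ρ W r 0) (intW^[s] Ξ) = wNormW (wt σ b ρ W r s) Ξ := by
  unfold wNormW
  rw [tsum_eq_tsum_add_of_forall_lt s fun α hα => by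
    rw [coeff_intW_iterate_lt s Ξ α hα, wNorm_zero]]
  refine tsum_congr fun α => ?_
  rw [coeff_intW_iterate_add, wNorm_smul]
  unfold wNorm
  rw [← ENNReal.tsum_mul_left]
  refine tsum_congr fun n => ?_
  have : ‖(α ! : ℂ) / ((α + s)! : ℂ)‖ₑ = ENNReal.ofReal ((α ! : ℝ) / ((α + s)! : ℝ)) := by
    rw [← ofReal_norm, norm_div, Complex.norm_natCast, Complex.norm_natCast]
  rw [this, mul_left_comm, ← ENNReal.ofReal_mul (by positivity)]
  congr 2
  unfold wt
  have := Nat.factorial_pos (α + s)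
  simp only [add_zero, ← add_assoc]
  field_simp

theorem coeff_opD (R ρ : ℝ) (F : ℕ → (Var → ℂ) → ℂ) (Ψ : PowerSeries (MvPowerSeries Var ℂ))
    (α : ℕ) : PowerSeries.coeff α (opD R ρ F Ψ) = ∑ j ∈ Finset.range (α + 1),
      majorantSeries R ρ (α + 1) (F j) *
        MvPowerSeries.pderiv ℂ (U j) (PowerSeries.coeff α Ψ) := by
  have : (α ! : ℂ) ≠ 0 := Nat.cast_ne_zero.mpr (Nat.factorial_ne_zero α)
  simp only [opD, PowerSeries.coeff_mk, comp, Derivation.map_smul, mul_smul_comm, ← Finset.smul_sum,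
    smul_smul, inv_mul_cancel₀ this, one_smul]

theorem opD_add (R ρ : ℝ) (F : ℕ → (Var → ℂ) → ℂ) (Φ Ψ : PowerSeries (MvPowerSeries Var ℂ)) :
    opD R ρ F (Φ + Ψ) = opD R ρ F Φ + opD R ρ F Ψ := by
  refine PowerSeries.ext fun α => ?_
  simp only [map_add, coeff_opD, mul_add, Finset.sum_add_distrib]

theorem dVar_add (i : Var) (Φ Ψ : PowerSeries (MvPowerSeries Var ℂ)) :
    dVar i (Φ + Ψ) = dVar i Φ + dVar i Ψ := by
  refine PowerSeries.ext fun α => ?_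
  simp only [map_add, dVar, PowerSeries.coeff_mk]

theorem intW_add (Φ Ψ : PowerSeries (MvPowerSeries Var ℂ)) :
    intW (Φ + Ψ) = intW Φ + intW Ψ := by
  refine PowerSeries.ext fun α => ?_
  rw [map_add]
  simp only [intW, PowerSeries.coeff_mk]
  rcases α with _ | α
  · simp
  · simp only [map_add, smul_add]

theorem intW_iterate_add (s : ℕ) (Φ Ψ : PowerSeries (MvPowerSeries Var ℂ)) :
    intW^[s] (Φ + Ψ) = intW^[s] Φ + intW^[s] Ψ := by
  induction s with
  | zero => rfl
  | succ s ih => simp only [Function.iterate_succ_apply', ih, intW_add]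

/-! ### Formal series in given variables -/

/-- The formal series that only involve variables in the set `v`. -/
def seriesIn (v : Set Var) : AddSubgroup (MvPowerSeries Var ℂ) where
  carrier := {χ | ∀ n, MvPowerSeries.coeff n χ ≠ 0 → (n.support : Set Var) ⊆ v}
  zero_mem' := fun n h => absurd (map_zero _) h
  add_mem' := fun {χ ψ} hχ hψ n h => by
    by_cases h₁ : MvPowerSeries.coeff n χ = 0
    · refine hψ n fun h₂ => h ?_
      rw [map_add, h₁, h₂, add_zero]
    · exact hχ n h₁
  neg_mem' := fun {χ} hχ n h => hχ n fun h₁ => h (by rw [map_neg, h₁, neg_zero])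

theorem seriesIn_mono {v v' : Set Var} (h : v ⊆ v') {χ : MvPowerSeries Var ℂ}
    (hχ : χ ∈ seriesIn v) : χ ∈ seriesIn v' := fun n hn => (hχ n hn).trans h

theorem smul_mem_seriesIn {v : Set Var} (c : ℂ) {χ : MvPowerSeries Var ℂ}
    (hχ : χ ∈ seriesIn v) : c • χ ∈ seriesIn v := fun n hn => hχ n fun h => hn (by simp [h])

theorem mul_mem_seriesIn {v : Set Var} {χ ψ : MvPowerSeries Var ℂ}
    (hχ : χ ∈ seriesIn v) (hψ : ψ ∈ seriesIn v) : χ * ψ ∈ seriesIn v := by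
  classical
  intro n hn
  rw [MvPowerSeries.coeff_mul] at hn
  obtain ⟨p, hp, hne⟩ := Finset.exists_ne_zero_of_sum_ne_zero hn
  rw [← mem_antidiagonal.mp hp]
  intro i hi
  rcases Finset.mem_union.mp (Finsupp.support_add hi) with h | h
  · exact hχ _ (left_ne_zero_of_mul hne) h
  · exact hψ _ (right_ne_zero_of_mul hne) h

theorem pderiv_mem_seriesIn {v : Set Var} (i : Var) {χ : MvPowerSeries Var ℂ}
    (hχ : χ ∈ seriesIn v) : MvPowerSeries.pderiv ℂ i χ ∈ seriesIn v := by
  intro n hn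
  rw [MvPowerSeries.coeff_pderiv] at hn
  refine subset_trans ?_ (hχ _ (left_ne_zero_of_mul hn))
  exact_mod_cast Finsupp.support_mono le_self_add

theorem majorantSeries_mem_seriesIn (R ρ : ℝ) (α : ℕ) (f : (Var → ℂ) → ℂ) :
    majorantSeries R ρ α f ∈ seriesIn (varsUpTo α) := by
  intro n hn
  by_contra h
  exact hn (if_neg h)

theorem varsUpTo_mono : Monotone varsUpTo := fun _ _ h =>
  Set.union_subset_union_right _ (Set.image_mono (Set.Iic_subset_Iic.mpr h))

theorem mem_formalG_iff {Ψ : PowerSeries (MvPowerSeries Var ℂ)} :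
    Ψ ∈ formalG ↔ ∀ α, PowerSeries.coeff α Ψ ∈ seriesIn (varsUpTo α) := by
  refine forall_congr' fun α => forall_congr' fun n => ?_
  have : (α ! : ℂ) ≠ 0 := Nat.cast_ne_zero.mpr (Nat.factorial_ne_zero α)
  simp [comp, this]

theorem add_mem_formalG {Φ Ψ : PowerSeries (MvPowerSeries Var ℂ)} (hΦ : Φ ∈ formalG)
    (hΨ : Ψ ∈ formalG) : Φ + Ψ ∈ formalG := by
  rw [mem_formalG_iff] at *
  intro α
  rw [map_add]
  exact add_mem (hΦ α) (hΨ α)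

theorem sum_mem_formalG {ι : Type*} (s : Finset ι) {Φ : ι → PowerSeries (MvPowerSeries Var ℂ)}
    (h : ∀ i ∈ s, Φ i ∈ formalG) : ∑ i ∈ s, Φ i ∈ formalG := by
  simp only [mem_formalG_iff] at *
  intro α
  rw [map_sum]
  exact sum_mem fun i hi => h i hi α

/-- Integration carries index `α` to `α + s`, where the variables `U_h` with `h ≤ α + s` are
allowed. This compensates for the variable `U_{α+1}` introduced by `opD`. -/
theorem mul_intW_iterate_mem_formalG {B Ξ : PowerSeries (MvPowerSeries Var ℂ)} {s : ℕ}
    (hB : ∀ β, PowerSeries.coeff β B ∈ seriesIn (varsUpTo 0))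
    (hΞ : ∀ α, PowerSeries.coeff α Ξ ∈ seriesIn (varsUpTo (α + s))) :
    B * intW^[s] Ξ ∈ formalG := by
  rw [mem_formalG_iff]
  intro n
  rw [PowerSeries.coeff_mul]
  refine sum_mem fun p hp => mul_mem_seriesIn (seriesIn_mono (varsUpTo_mono n.zero_le) (hB _)) ?_
  have hp' := mem_antidiagonal.mp hp
  by_cases h : p.2 < s
  · rw [coeff_intW_iterate_lt s Ξ _ h]
    exact zero_mem _
  · obtain ⟨α, hα⟩ := Nat.exists_eq_add_of_le' (not_lt.mp h)
    rw [hα, coeff_intW_iterate_add]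
    exact smul_mem_seriesIn _ (seriesIn_mono (varsUpTo_mono (by omega)) (hΞ α))

theorem coeff_bigB_mem (R ρ : ℝ) (b : ℂ → ℂ → ℂ → ℂ → ℂ) (β : ℕ) :
    PowerSeries.coeff β (bigB R ρ b) ∈ seriesIn (varsUpTo 0) := by
  rw [bigB, PowerSeries.coeff_mk]
  exact smul_mem_seriesIn _ (majorantSeries_mem_seriesIn _ _ _ _)

theorem coeff_opD_mem {R ρ : ℝ} {F : ℕ → (Var → ℂ) → ℂ}
    {Ψ : PowerSeries (MvPowerSeries Var ℂ)} (hΨ : Ψ ∈ formalG) (α : ℕ) :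
    PowerSeries.coeff α (opD R ρ F Ψ) ∈ seriesIn (varsUpTo (α + 1)) := by
  rw [coeff_opD]
  exact sum_mem fun j _ => mul_mem_seriesIn (majorantSeries_mem_seriesIn _ _ _ _)
    (pderiv_mem_seriesIn _ (seriesIn_mono (varsUpTo_mono α.le_succ) (mem_formalG_iff.mp hΨ α)))

theorem coeff_dVar (i : Var) (Ψ : PowerSeries (MvPowerSeries Var ℂ)) (α : ℕ) :
    PowerSeries.coeff α (dVar i Ψ) = MvPowerSeries.pderiv ℂ i (PowerSeries.coeff α Ψ) :=
  PowerSeries.coeff_mk _ _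

theorem coeff_mul_intW_iterate_eq_zero {B Ξ : PowerSeries (MvPowerSeries Var ℂ)} {s N : ℕ}
    (hs : 1 ≤ s) (hΞ : ∀ α < N, PowerSeries.coeff α Ξ = 0) :
    ∀ α < N + 1, PowerSeries.coeff α (B * intW^[s] Ξ) = 0 := by
  intro n hn
  rw [PowerSeries.coeff_mul]
  refine sum_eq_zero fun p hp => ?_
  have hp' := mem_antidiagonal.mp hp
  by_cases h : p.2 < s
  · rw [coeff_intW_iterate_lt s Ξ _ h, mul_zero]
  · obtain ⟨α, hα⟩ := Nat.exists_eq_add_of_le' (not_lt.mp h)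
    rw [hα, coeff_intW_iterate_add, hΞ α (by omega), smul_zero, mul_zero]

/-! ### Linear equations whose operator raises the order in `W` -/

/-- Neumann series: `T^k I` vanishes below order `k` in `W`, so the coefficient of index `α` of the
solution is that of the partial sum with `α + 1` terms. The norm bound is the geometric series of
ratio `1/2`. -/
theorem exists_eq_add_of_order_raising
    (T : PowerSeries (MvPowerSeries Var ℂ) →+ PowerSeries (MvPowerSeries Var ℂ))
    (hT : ∀ Φ N, (∀ α < N, PowerSeries.coeff α Φ = 0) →
      ∀ α < N + 1, PowerSeries.coeff α (T Φ) = 0)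
    (hTG : ∀ Φ ∈ formalG, T Φ ∈ formalG)
    (ω : ℕ → (Var →₀ ℕ) → ℝ) (hω : ∀ Φ, wNormW ω (T Φ) ≤ 2⁻¹ * wNormW ω Φ)
    {I : PowerSeries (MvPowerSeries Var ℂ)} (hI : I ∈ formalG) :
    ∃ Ψ ∈ formalG, Ψ = T Ψ + I ∧ wNormW ω Ψ ≤ 2 * wNormW ω I := by
  have hord : ∀ k, ∀ α < k, PowerSeries.coeff α (T^[k] I) = 0 := by
    intro k
    induction k with
    | zero => simp
    | succ k ih => rw [Function.iterate_succ_apply']; exact hT _ k ih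
  have hmem : ∀ k, T^[k] I ∈ formalG := by
    intro k
    induction k with
    | zero => exact hI
    | succ k ih => rw [Function.iterate_succ_apply']; exact hTG _ ih
  have hnorm : ∀ k, wNormW ω (T^[k] I) ≤ 2⁻¹ ^ k * wNormW ω I := by
    intro k
    induction k with
    | zero => simp
    | succ k ih =>
      rw [Function.iterate_succ_apply', pow_succ']
      refine (hω _).trans ?_
      rw [mul_assoc]
      gcongr
  set P : ℕ → PowerSeries (MvPowerSeries Var ℂ) := fun N => ∑ k ∈ range N, T^[k] I with hP
  set Ψ : PowerSeries (MvPowerSeries Var ℂ) :=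
    PowerSeries.mk fun α => PowerSeries.coeff α (P (α + 1)) with hΨ
  have hcoeff : ∀ N α, α < N → PowerSeries.coeff α Ψ = PowerSeries.coeff α (P N) := by
    intro N α hα
    rw [hΨ, PowerSeries.coeff_mk, hP]
    simp only [map_sum]
    refine sum_subset (range_subset_range.mpr hα) fun k _ hk => ?_
    exact hord k α (by simpa using hk)
  refine ⟨Ψ, ?_, ?_, ?_⟩
  · rw [mem_formalG_iff]
    intro α
    rw [hcoeff (α + 1) α (by omega)]
    exact mem_formalG_iff.mp (sum_mem_formalG _ fun k _ => hmem k) α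
  · refine PowerSeries.ext fun α => ?_
    -- `Ψ` and `P α` agree below index `α`; as `T` raises the order, `T Ψ` and `T (P α)` still agree
    -- at index `α` itself.
    have h₁ : PowerSeries.coeff α (T (Ψ - P α)) = 0 := by
      refine hT _ α (fun β hβ => ?_) α (by omega)
      rw [map_sub, hcoeff α β hβ, sub_self]
    have h₂ : P (α + 1) = T (P α) + I := by
      simp only [hP]
      rw [sum_range_succ', map_sum]
      simp [Function.iterate_succ_apply']
    rw [map_sub, map_sub, sub_eq_zero] at h₁
    rw [map_add, h₁, ← map_add, ← h₂]
    exact hcoeff (α + 1) α (by omega)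
  · calc wNormW ω Ψ ≤ ∑' k, wNormW ω (T^[k] I) := by
          unfold wNormW wNorm
          refine le_of_le_of_eq (ENNReal.tsum_le_tsum fun α => ?_) ENNReal.tsum_comm
          refine le_of_le_of_eq (ENNReal.tsum_le_tsum fun n => ?_) ENNReal.tsum_comm
          rw [ENNReal.tsum_mul_right, hcoeff (α + 1) α (by omega)]
          gcongr
          simp only [hP, map_sum]
          exact (enorm_sum_le _ _).trans (ENNReal.sum_le_tsum _)
      _ ≤ ∑' k : ℕ, 2⁻¹ ^ k * wNormW ω I := ENNReal.tsum_le_tsum hnorm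
      _ = 2 * wNormW ω I := by
          rw [ENNReal.tsum_mul_right, ENNReal.tsum_geometric, ENNReal.one_sub_inv_two, inv_inv]

/-! ### The norm of the space `G` -/

theorem eTerm_comp_mul_pow (ρ σ b V₀ V₁ δ W : ℝ) (hW : 0 < W) (α : ℕ)
    (Ψ : PowerSeries (MvPowerSeries Var ℂ)) (n : Var →₀ ℕ) :
    ENNReal.ofReal (eTerm ρ σ b V₀ V₁ δ α (comp α Ψ) n) * ENNReal.ofReal (W ^ α) =
      ‖MvPowerSeries.coeff n (PowerSeries.coeff α Ψ)‖ₑ *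
        ENNReal.ofReal (wt σ b ρ W (radius b V₀ V₁ δ) 0 α n) := by
  rw [← ENNReal.ofReal_mul' (by positivity), ← ofReal_norm, ← ENNReal.ofReal_mul (norm_nonneg _)]
  congr 1
  simp only [eTerm, comp, wt, monom, map_smul, smul_eq_mul, norm_mul, Complex.norm_natCast,
    Real.exp_neg, add_zero]
  field_simp

section SpaceG

variable {ρ σ b V₀ V₁ δ W : ℝ}

theorem radius_pos (hV₀ : 0 < V₀) (hV₁ : 0 < V₁) (hδ : 0 < δ) (i : Var) :
    0 < radius b V₀ V₁ δ i := by
  cases i <;> simp only [radius] <;> positivity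

theorem eTerm_nonneg (hV₀ : 0 < V₀) (hV₁ : 0 < V₁) (hδ : 0 < δ) (α : ℕ)
    (χ : MvPowerSeries Var ℂ) (n : Var →₀ ℕ) : 0 ≤ eTerm ρ σ b V₀ V₁ δ α χ n := by
  have : 0 < n.prod fun i m => radius b V₀ V₁ δ i ^ m := monom_pos (radius_pos hV₀ hV₁ hδ) n
  unfold eTerm
  positivity

theorem wNormW_eq_tsum (hW : 0 < W) (Ψ : PowerSeries (MvPowerSeries Var ℂ)) :
    wNormW (wt σ b ρ W (radius b V₀ V₁ δ) 0) Ψ =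
      ∑' α, (∑' n, ENNReal.ofReal (eTerm ρ σ b V₀ V₁ δ α (comp α Ψ) n)) *
        ENNReal.ofReal (W ^ α) := by
  unfold wNormW wNorm
  simp_rw [← eTerm_comp_mul_pow ρ σ b V₀ V₁ δ W hW, ENNReal.tsum_mul_right]

theorem ofReal_eNorm (hV₀ : 0 < V₀) (hV₁ : 0 < V₁) (hδ : 0 < δ) {α : ℕ}
    {χ : MvPowerSeries Var ℂ} (h : Summable (eTerm ρ σ b V₀ V₁ δ α χ)) :
    ENNReal.ofReal (eNorm ρ σ b V₀ V₁ δ α χ) =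
      ∑' n, ENNReal.ofReal (eTerm ρ σ b V₀ V₁ δ α χ n) :=
  ENNReal.ofReal_tsum_of_nonneg (eTerm_nonneg hV₀ hV₁ hδ α χ) h

theorem eNorm_nonneg (hV₀ : 0 < V₀) (hV₁ : 0 < V₁) (hδ : 0 < δ) (α : ℕ)
    (χ : MvPowerSeries Var ℂ) : 0 ≤ eNorm ρ σ b V₀ V₁ δ α χ :=
  tsum_nonneg (eTerm_nonneg hV₀ hV₁ hδ α χ)

theorem summable_of_tsum_ofReal_ne_top {ι : Type*} {f : ι → ℝ} (hf : ∀ i, 0 ≤ f i)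
    (h : ∑' i, ENNReal.ofReal (f i) ≠ ⊤) : Summable f := by
  have := ENNReal.summable_toReal h
  simpa only [ENNReal.toReal_ofReal (hf _)] using this

/-- A finite total sum forces each inner sum to be finite because `W ^ α > 0`; hence both
summability conditions collapse to one finiteness statement. -/
theorem mem_spaceG_iff (hV₀ : 0 < V₀) (hV₁ : 0 < V₁) (hδ : 0 < δ) (hW : 0 < W)
    {Ψ : PowerSeries (MvPowerSeries Var ℂ)} :
    Ψ ∈ spaceG ρ σ b V₀ V₁ δ W ↔
      Ψ ∈ formalG ∧ wNormW (wt σ b ρ W (radius b V₀ V₁ δ) 0) Ψ ≠ ⊤ := by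
  have hprod : (∀ α, Summable (eTerm ρ σ b V₀ V₁ δ α (comp α Ψ))) → ∀ α,
      (∑' n, ENNReal.ofReal (eTerm ρ σ b V₀ V₁ δ α (comp α Ψ) n)) * ENNReal.ofReal (W ^ α) =
      ENNReal.ofReal (eNorm ρ σ b V₀ V₁ δ α (comp α Ψ) * W ^ α) := fun h α => by
    rw [ENNReal.ofReal_mul' (by positivity), ofReal_eNorm hV₀ hV₁ hδ (h α)]
  have hnn : ∀ α, 0 ≤ eNorm ρ σ b V₀ V₁ δ α (comp α Ψ) * W ^ α := fun α =>
    mul_nonneg (eNorm_nonneg hV₀ hV₁ hδ _ _) (by positivity)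
  refine and_congr_right fun _ => ?_
  rw [wNormW_eq_tsum hW]
  constructor
  · rintro ⟨h₁, h₂⟩
    simp_rw [hprod h₁]
    exact h₂.tsum_ofReal_ne_top
  · intro h
    have h₁ : ∀ α, Summable (eTerm ρ σ b V₀ V₁ δ α (comp α Ψ)) := by
      intro α
      refine summable_of_tsum_ofReal_ne_top (eTerm_nonneg hV₀ hV₁ hδ _ _) fun htop => ?_
      have := ENNReal.ne_top_of_tsum_ne_top h α
      rw [htop, ENNReal.top_mul (by simpa using pow_pos hW α)] at this
      exact this rfl
    simp_rw [hprod h₁] at h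
    exact ⟨h₁, summable_of_tsum_ofReal_ne_top hnn h⟩

theorem ofReal_gNorm (hV₀ : 0 < V₀) (hV₁ : 0 < V₁) (hδ : 0 < δ) (hW : 0 < W)
    {Ψ : PowerSeries (MvPowerSeries Var ℂ)} (hΨ : Ψ ∈ spaceG ρ σ b V₀ V₁ δ W) :
    ENNReal.ofReal (gNorm ρ σ b V₀ V₁ δ W Ψ) =
      wNormW (wt σ b ρ W (radius b V₀ V₁ δ) 0) Ψ := by
  obtain ⟨_, h₁, h₂⟩ := hΨ
  have hnn : ∀ α, 0 ≤ eNorm ρ σ b V₀ V₁ δ α (comp α Ψ) * W ^ α := fun α =>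
    mul_nonneg (eNorm_nonneg hV₀ hV₁ hδ _ _) (by positivity)
  rw [gNorm, ENNReal.ofReal_tsum_of_nonneg hnn h₂, wNormW_eq_tsum hW]
  refine tsum_congr fun α => ?_
  rw [ENNReal.ofReal_mul' (by positivity), ofReal_eNorm hV₀ hV₁ hδ (h₁ α)]

theorem gNorm_nonneg (hV₀ : 0 < V₀) (hV₁ : 0 < V₁) (hδ : 0 < δ) (hW : 0 < W)
    (Ψ : PowerSeries (MvPowerSeries Var ℂ)) : 0 ≤ gNorm ρ σ b V₀ V₁ δ W Ψ :=
  tsum_nonneg fun _ => mul_nonneg (eNorm_nonneg hV₀ hV₁ hδ _ _) (by positivity)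

theorem existsUnique_spaceG (hV₀ : 0 < V₀) (hV₁ : 0 < V₁) (hδ : 0 < δ) (hW : 0 < W)
    (T : PowerSeries (MvPowerSeries Var ℂ) →+ PowerSeries (MvPowerSeries Var ℂ))
    (hT : ∀ Φ N, (∀ α < N, PowerSeries.coeff α Φ = 0) →
      ∀ α < N + 1, PowerSeries.coeff α (T Φ) = 0)
    (hTG : ∀ Φ ∈ formalG, T Φ ∈ formalG)
    (hω : ∀ Φ, wNormW (wt σ b ρ W (radius b V₀ V₁ δ) 0) (T Φ) ≤
      2⁻¹ * wNormW (wt σ b ρ W (radius b V₀ V₁ δ) 0) Φ)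
    {I : PowerSeries (MvPowerSeries Var ℂ)} (hI : I ∈ spaceG ρ σ b V₀ V₁ δ W) :
    ∃ Ψ ∈ spaceG ρ σ b V₀ V₁ δ W,
      (∀ Φ ∈ spaceG ρ σ b V₀ V₁ δ W, (Φ = T Φ + I ↔ Φ = Ψ)) ∧
      gNorm ρ σ b V₀ V₁ δ W Ψ ≤ 2 * gNorm ρ σ b V₀ V₁ δ W I := by
  set ω := wt σ b ρ W (radius b V₀ V₁ δ) 0 with hωdef
  have hI' := (mem_spaceG_iff hV₀ hV₁ hδ hW).mp hI
  obtain ⟨Ψ, hΨG, hΨ, hΨI⟩ := exists_eq_add_of_order_raising T hT hTG ω hω hI'.1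
  have hΨtop : wNormW ω Ψ ≠ ⊤ :=
    ne_top_of_le_ne_top (ENNReal.mul_ne_top (by simp) hI'.2) hΨI
  have hΨmem : Ψ ∈ spaceG ρ σ b V₀ V₁ δ W := (mem_spaceG_iff hV₀ hV₁ hδ hW).mpr ⟨hΨG, hΨtop⟩
  refine ⟨Ψ, hΨmem, fun Φ hΦ => ⟨fun h => ?_, fun h => h ▸ hΨ⟩, ?_⟩
  · have hΦ' := (mem_spaceG_iff hV₀ hV₁ hδ hW).mp hΦ
    have hdiff : Φ - Ψ = T (Φ - Ψ) := by
      rw [map_sub]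
      nth_rewrite 1 [h, hΨ]
      abel
    have hle : wNormW ω (Φ - Ψ) ≤ 2⁻¹ * wNormW ω (Φ - Ψ) := by
      nth_rewrite 1 [hdiff]
      exact hω _
    have htop : wNormW ω (Φ - Ψ) ≠ ⊤ := by
      rw [sub_eq_add_neg]
      refine ne_top_of_le_ne_top ?_ (wNormW_add_le _ _ _)
      rw [wNormW_neg]
      exact ENNReal.add_ne_top.mpr ⟨hΦ'.2, hΨtop⟩
    -- A norm bounded by half of itself vanishes, provided it is finite; this is where membership of
    -- both series in the space is used.
    have hzero : wNormW ω (Φ - Ψ) = 0 := by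
      by_contra hne
      rw [mul_comm, ← ENNReal.div_eq_inv_mul.trans (mul_comm _ _)] at hle
      exact absurd hle (not_le.mpr (ENNReal.half_lt_self hne htop))
    exact sub_eq_zero.mp (eq_zero_of_wNormW_eq_zero
      (fun α n => wt_pos (radius_pos hV₀ hV₁ hδ) hW 0 α n) hzero)
  · rw [← ENNReal.ofReal_le_ofReal_iff (mul_nonneg zero_le_two (gNorm_nonneg hV₀ hV₁ hδ hW I)),
      ENNReal.ofReal_mul zero_le_two, ofReal_gNorm hV₀ hV₁ hδ hW hΨmem,
      ofReal_gNorm hV₀ hV₁ hδ hW hI]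
    simpa using hΨI

end SpaceG

/-! ### Norm estimates for the operators -/

/-- The gain obtained in the component of index `α` from `s` integrations in `W`, of which `t` are
not compensated by a differentiation. -/
def gain (σ b ρ W : ℝ) (s t α : ℕ) : ℝ :=
  Real.exp (-(σ * ρ / ((α : ℝ) + 2) ^ b)) * W ^ s / ((α : ℝ) + 1) ^ t

theorem gain_nonneg {σ b ρ W : ℝ} (hW : 0 ≤ W) (s t α : ℕ) : 0 ≤ gain σ b ρ W s t α := by
  unfold gain
  positivity

/-- With `y = ρ/(α+2)^b` one has `ρ^Q = y^Q (α+2)^(bQ)`, and `y^Q exp(-σy) ≤ Q!/σ^Q` by a single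
term of the exponential series. The remaining power of `α+1` is nonpositive by `hE`, so the bound
depends neither on `ρ` nor on `α`. -/
theorem rpow_mul_exp_neg_le {σ b : ℝ} (hσ : 0 < σ) (hb : 0 < b) (Q t : ℕ) {E ρ : ℝ}
    (hρ : 0 < ρ) (hE : E + b * Q ≤ t) (α : ℕ) :
    ρ ^ Q * ((α : ℝ) + 1) ^ E * Real.exp (-(σ * ρ / ((α : ℝ) + 2) ^ b)) / ((α : ℝ) + 1) ^ t ≤
      (Q ! : ℝ) / σ ^ Q * 2 ^ (b * Q) := by
  have hα : (1 : ℝ) ≤ (α : ℝ) + 1 := by linarith [(Nat.cast_nonneg α : (0 : ℝ) ≤ α)]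
  set y : ℝ := ρ / ((α : ℝ) + 2) ^ b with hy
  have hypos : 0 < y := by positivity
  have h₁ : y ^ Q * Real.exp (-(σ * y)) ≤ (Q ! : ℝ) / σ ^ Q := by
    have := Real.pow_div_factorial_le_exp (σ * y) (by positivity) Q
    rw [Real.exp_neg, le_div_iff₀ (by positivity), ← div_eq_mul_inv, div_mul_eq_mul_div,
      div_le_iff₀ (Real.exp_pos _)]
    rw [div_le_iff₀ (by positivity), mul_pow] at this
    linarith
  have h₂ : ρ ^ Q = y ^ Q * (((α : ℝ) + 2) ^ (b * Q)) := by
    rw [hy, div_pow, Real.rpow_mul (by positivity), Real.rpow_natCast]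
    field_simp
  have h₃ : ((α : ℝ) + 2) ^ (b * Q) ≤ 2 ^ (b * Q) * ((α : ℝ) + 1) ^ (b * Q) := by
    rw [← Real.mul_rpow (by norm_num) (by positivity)]
    exact Real.rpow_le_rpow (by positivity) (by linarith) (by positivity)
  have h₄ : ((α : ℝ) + 1) ^ (b * Q) * ((α : ℝ) + 1) ^ E / ((α : ℝ) + 1) ^ t ≤ 1 := by
    rw [div_le_one (by positivity), ← Real.rpow_add (by positivity), ← Real.rpow_natCast]
    exact Real.rpow_le_rpow_of_exponent_le hα (by linarith)
  calc _ = y ^ Q * Real.exp (-(σ * y)) * ((α : ℝ) + 2) ^ (b * Q) *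
        ((α : ℝ) + 1) ^ E / ((α : ℝ) + 1) ^ t := by
        rw [h₂, hy, mul_div_assoc σ]; ring
    _ ≤ (Q ! : ℝ) / σ ^ Q * (2 ^ (b * Q) * ((α : ℝ) + 1) ^ (b * Q)) *
        ((α : ℝ) + 1) ^ E / ((α : ℝ) + 1) ^ t := by gcongr
    _ = (Q ! : ℝ) / σ ^ Q * 2 ^ (b * Q) * (((α : ℝ) + 1) ^ (b * Q) * ((α : ℝ) + 1) ^ E /
        ((α : ℝ) + 1) ^ t) := by ring
    _ ≤ (Q ! : ℝ) / σ ^ Q * 2 ^ (b * Q) * 1 := by gcongr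
    _ = _ := mul_one _

section Estimates

variable {σ b ρ W : ℝ} {r : Var → ℝ}

theorem exp_rb_add_le (hσ : 0 ≤ σ) (hρ : 0 ≤ ρ) {s : ℕ} (hs : 1 ≤ s) (α : ℕ) :
    Real.exp (-(σ * rb b (α + s) * ρ)) ≤
      Real.exp (-(σ * ρ / ((α : ℝ) + 2) ^ b)) * Real.exp (-(σ * rb b α * ρ)) := by
  rw [← Real.exp_add]
  refine Real.exp_le_exp.mpr ?_
  have := mul_le_mul_of_nonneg_left (rb_add_sub_rb b α s hs) (mul_nonneg hσ hρ)
  have e : σ * ρ * (1 / ((α : ℝ) + 2) ^ b) = σ * ρ / ((α : ℝ) + 2) ^ b := by ring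
  rw [e] at this
  nlinarith

theorem factorial_inv_le (n α t : ℕ) :
    1 / ((n + α + t)! : ℝ) ≤ 1 / ((n + α)! : ℝ) / ((α : ℝ) + 1) ^ t := by
  rw [div_div]
  have h : (n + α)! * (n + α + 1) ^ t ≤ (n + α + t)! := Nat.factorial_mul_pow_le_factorial
  have h' : ((n + α)! : ℝ) * ((α : ℝ) + 1) ^ t ≤ ((n + α + t)! : ℝ) := by
    refine le_trans ?_ (Nat.cast_le.mpr h)
    push_cast
    gcongr
    linarith [(Nat.cast_nonneg n : (0 : ℝ) ≤ n)]
  exact one_div_le_one_div_of_le (by positivity) h'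

theorem wt_le_gain (hr : ∀ i, 0 < r i) (hW : 0 < W) (hσ : 0 ≤ σ) (hρ : 0 ≤ ρ) {s : ℕ}
    (hs : 1 ≤ s) (α : ℕ) (n : Var →₀ ℕ) :
    wt σ b ρ W r s α n ≤ gain σ b ρ W s s α * wt σ b ρ W r 0 α n := by
  have hm := monom_pos hr n
  have h₁ := exp_rb_add_le (b := b) hσ hρ hs α
  have h₂ := factorial_inv_le n.degree α s
  calc wt σ b ρ W r s α n = (α ! : ℝ) * multiFactorial n * monom r n * W ^ (α + s) *
        (1 / ((n.degree + α + s)! : ℝ)) * Real.exp (-(σ * rb b (α + s) * ρ)) := by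
        unfold wt; ring
    _ ≤ (α ! : ℝ) * multiFactorial n * monom r n * W ^ (α + s) *
        (1 / ((n.degree + α)! : ℝ) / ((α : ℝ) + 1) ^ s) *
        (Real.exp (-(σ * ρ / ((α : ℝ) + 2) ^ b)) * Real.exp (-(σ * rb b α * ρ))) := by gcongr
    _ = _ := by simp only [wt, gain, pow_add, add_zero]; ring

/-- Differentiation compares `n` with `n + e_i`, whose degree is larger by one. One of the `s` extra
factors of `(n.degree + α + s)!` is used to match this, which leaves `s - 1` factors for the gain.
-/
theorem wt_pderiv_le_gain (hr : ∀ i, 0 < r i) (hW : 0 < W) (hσ : 0 ≤ σ) (hρ : 0 ≤ ρ) {s : ℕ}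
    (hs : 1 ≤ s) (i : Var) (α : ℕ) (n : Var →₀ ℕ) :
    ((n i : ℝ) + 1) * wt σ b ρ W r s α n ≤
      (r i)⁻¹ * gain σ b ρ W s (s - 1) α * wt σ b ρ W r 0 α (n + Finsupp.single i 1) := by
  have hm := monom_pos hr n
  have hi := hr i
  have h₁ := exp_rb_add_le (b := b) hσ hρ hs α
  have h₂ := factorial_inv_le (n.degree + 1) α (s - 1)
  rw [show n.degree + 1 + α + (s - 1) = n.degree + α + s by omega] at h₂
  calc ((n i : ℝ) + 1) * wt σ b ρ W r s α n =
        ((n i : ℝ) + 1) * ((α ! : ℝ) * multiFactorial n * monom r n * W ^ (α + s)) *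
        (1 / ((n.degree + α + s)! : ℝ)) * Real.exp (-(σ * rb b (α + s) * ρ)) := by
        unfold wt; ring
    _ ≤ ((n i : ℝ) + 1) * ((α ! : ℝ) * multiFactorial n * monom r n * W ^ (α + s)) *
        (1 / ((n.degree + 1 + α)! : ℝ) / ((α : ℝ) + 1) ^ (s - 1)) *
        (Real.exp (-(σ * ρ / ((α : ℝ) + 2) ^ b)) * Real.exp (-(σ * rb b α * ρ))) := by gcongr
    _ = _ := by
        simp only [wt, gain, pow_add, add_zero, multiFactorial_add_single, monom_add,
          monom_single, map_add, Finsupp.degree_single, pow_one]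
        push_cast
        field_simp

theorem wNorm_dVar_le (hr : ∀ i, 0 < r i) (hW : 0 < W) (hσ : 0 ≤ σ) (hρ : 0 ≤ ρ) {s : ℕ}
    (hs : 1 ≤ s) (i : Var) (α : ℕ) (χ : MvPowerSeries Var ℂ) :
    wNorm (wt σ b ρ W r s α) (MvPowerSeries.pderiv ℂ i χ) ≤
      ENNReal.ofReal ((r i)⁻¹ * gain σ b ρ W s (s - 1) α) * wNorm (wt σ b ρ W r 0 α) χ :=
  wNorm_pderiv_le (mul_nonneg (inv_nonneg.mpr (hr i).le) (gain_nonneg hW.le _ _ _)) i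
    (wt_pderiv_le_gain hr hW hσ hρ hs i α) χ

/-- The losses multiply: `α + 1` values of `j`, the bound `A` for the majorants, and the bound `D`
for the inverse radii of the `U_j`. -/
theorem wNorm_coeff_opD_le (hr : ∀ i, 0 < r i) (hW : 0 < W) (hσ : 0 ≤ σ) (hρ : 0 ≤ ρ) {s : ℕ}
    (hs : 1 ≤ s) (R : ℝ) (F : ℕ → (Var → ℂ) → ℂ) (α : ℕ) {A D : ℝ} (hA : 0 ≤ A)
    (hF : ∀ j ≤ α, wNorm (monom r) (majorantSeries R ρ (α + 1) (F j)) ≤ ENNReal.ofReal A)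
    (hrU : ∀ j ≤ α, (r (U j))⁻¹ ≤ D)
    (Ψ : PowerSeries (MvPowerSeries Var ℂ)) :
    wNorm (wt σ b ρ W r s α) (PowerSeries.coeff α (opD R ρ F Ψ)) ≤
      ENNReal.ofReal (((α : ℝ) + 1) * A * D * gain σ b ρ W s (s - 1) α) *
        wNorm (wt σ b ρ W r 0 α) (PowerSeries.coeff α Ψ) := by
  have hD : 0 ≤ D := (inv_nonneg.mpr (hr (U 0)).le).trans (hrU 0 (Nat.zero_le _))
  have hg := gain_nonneg (σ := σ) (b := b) (ρ := ρ) hW.le s (s - 1) α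
  rw [coeff_opD]
  refine (wNorm_sum_le _ _ _).trans ?_
  have hterm : ∀ j ∈ range (α + 1), wNorm (wt σ b ρ W r s α)
      (majorantSeries R ρ (α + 1) (F j) * MvPowerSeries.pderiv ℂ (U j) (PowerSeries.coeff α Ψ)) ≤
      ENNReal.ofReal (A * (D * gain σ b ρ W s (s - 1) α)) *
        wNorm (wt σ b ρ W r 0 α) (PowerSeries.coeff α Ψ) := by
    intro j hj
    have hj' : j ≤ α := Nat.lt_succ_iff.mp (mem_range.mp hj)
    refine (wNorm_mul_le (fun p => (monom_pos hr p).le) (ω' := wt σ b ρ W r s α)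
      (fun p q => by simpa using wt_add_le hr hW hσ hρ s 0 α p q) _ _).trans ?_
    rw [ENNReal.ofReal_mul hA, mul_assoc]
    refine mul_le_mul' (hF j hj') ((wNorm_dVar_le hr hW hσ hρ hs (U j) α _).trans ?_)
    gcongr
    exact hrU j hj'
  refine (Finset.sum_le_sum hterm).trans (le_of_eq ?_)
  rw [sum_const, card_range, nsmul_eq_mul, ← mul_assoc, ← ENNReal.ofReal_natCast,
    ← ENNReal.ofReal_mul (Nat.cast_nonneg _)]
  push_cast
  congr 2
  ring

theorem wNormW_mul_intW_iterate_le (hr : ∀ i, 0 < r i) (hW : 0 < W) (hW₁ : W ≤ 1) (hσ : 0 < σ)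
    (hb : 0 < b) (hρ : 0 < ρ) {s : ℕ} (hs : 1 ≤ s) {B Ξ Ψ : PowerSeries (MvPowerSeries Var ℂ)}
    {K A E : ℝ} {D q t : ℕ} (hK : 0 ≤ K) (hA : 0 ≤ A)
    (hB : ∑' β, ENNReal.ofReal (W ^ β) * wNorm (monom r) (PowerSeries.coeff β B) ≤
      ENNReal.ofReal (K * ρ ^ D))
    (hΞ : ∀ α, wNorm (wt σ b ρ W r s α) (PowerSeries.coeff α Ξ) ≤
      ENNReal.ofReal (A * ((α : ℝ) + 1) ^ E * ρ ^ q * gain σ b ρ W s t α) *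
        wNorm (wt σ b ρ W r 0 α) (PowerSeries.coeff α Ψ))
    (hE : E + b * (D + q : ℕ) ≤ t) :
    wNormW (wt σ b ρ W r 0) (B * intW^[s] Ξ) ≤
      ENNReal.ofReal (K * A * (((D + q)! : ℝ) / σ ^ (D + q) * 2 ^ (b * (D + q : ℕ))) * W) *
        wNormW (wt σ b ρ W r 0) Ψ := by
  refine (wNormW_mul_le hW.le (fun p => (monom_pos hr p).le)
    (fun β α p q => wt_add_le hr hW hσ.le hρ.le 0 β α p q) _ _).trans ?_
  rw [wNormW_intW_iterate]
  refine (mul_le_mul_left hB _).trans ?_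
  unfold wNormW
  rw [← ENNReal.tsum_mul_left, ← ENNReal.tsum_mul_left]
  refine ENNReal.tsum_le_tsum fun α => ?_
  refine (mul_le_mul_right (hΞ α) _).trans ?_
  rw [← mul_assoc, ← ENNReal.ofReal_mul (by positivity)]
  refine mul_le_mul_left (ENNReal.ofReal_le_ofReal ?_) _
  -- Only one power of `W` is kept; it suffices to make the operator small.
  have hWs : W ^ s ≤ W := by simpa using pow_le_pow_of_le_one hW.le hW₁ hs
  calc _ = K * A * (ρ ^ (D + q) * ((α : ℝ) + 1) ^ E *
        Real.exp (-(σ * ρ / ((α : ℝ) + 2) ^ b)) / ((α : ℝ) + 1) ^ t) * W ^ s := by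
        unfold gain; rw [pow_add]; ring
    _ ≤ _ := by
        gcongr
        exact rpow_mul_exp_neg_le hσ hb (D + q) t hρ hE α

end Estimates

end InfVar
end

noncomputable section
namespace InfVar

open Metric Filter Topology

/-! ### Separately holomorphic functions of two variables -/

/-- Functions on `D(0, r₁) × D(0, r₂)` that are holomorphic in each variable and bounded on
smaller closed bidiscs. -/
structure SepHol (r₁ r₂ : ℝ) (c : ℂ → ℂ → ℂ) : Prop where
  left : ∀ z ∈ ball (0 : ℂ) r₂, DifferentiableOn ℂ (fun t => c t z) (ball 0 r₁)
  right : ∀ t ∈ ball (0 : ℂ) r₁, DifferentiableOn ℂ (c t) (ball 0 r₂)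
  bdd : ∀ s₁ < r₁, ∀ s₂ < r₂, ∃ M : ℝ, ∀ t z : ℂ, ‖t‖ ≤ s₁ → ‖z‖ ≤ s₂ → ‖c t z‖ ≤ M

/-- The Schwarz lemma applied twice: to `f`, which bounds the slope function by `2 * M / r`, and
then to the slope function itself, whose value at `z` is the derivative. -/
theorem norm_slope_sub_deriv_le {f : ℂ → ℂ} {z h : ℂ} {r M : ℝ}
    (hf : DifferentiableOn ℂ f (ball z r)) (hM : ∀ w ∈ ball z r, ‖f w‖ ≤ M) (h₀ : h ≠ 0)
    (hr : ‖h‖ < r) : ‖h⁻¹ * (f (z + h) - f z) - deriv f z‖ ≤ 2 * (2 * M / r) / r * ‖h‖ := by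
  have hrpos : 0 < r := (norm_nonneg h).trans_lt hr
  have hz : z ∈ ball z r := mem_ball_self hrpos
  have hzh : z + h ∈ ball z r := by simpa using hr
  have hg : ∀ w ∈ ball z r, ‖dslope f z w‖ ≤ 2 * M / r := fun w hw =>
    Complex.norm_dslope_le_div_of_mapsTo_ball hf (fun v hv => by
      rw [mem_closedBall, dist_eq_norm]
      linarith [norm_sub_le (f v) (f z), hM v hv, hM z hz]) hw
  have hd : DifferentiableOn ℂ (dslope f z) (ball z r) :=
    (Complex.differentiableOn_dslope (isOpen_ball.mem_nhds hz)).mpr hf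
  have := Complex.dist_le_div_mul_dist_of_mapsTo_ball (R₂ := 2 * (2 * M / r)) hd (fun v hv => by
    rw [mem_closedBall, dist_eq_norm]
    linarith [norm_sub_le (dslope f z v) (dslope f z z), hg v hv, hg z hz]) hzh
  rw [dslope_same, dslope_of_ne _ (by simpa using h₀), slope_def_module, dist_eq_norm] at this
  simpa [dist_eq_norm] using this

/-- Bounds for the derivative are Cauchy's inequality. Holomorphy in the other variable holds
because the difference quotients in `z` converge locally uniformly in `t`, by
`norm_slope_sub_deriv_le` with a bound uniform in `t`. -/
theorem SepHol.deriv_right {r₁ r₂ : ℝ} {c : ℂ → ℂ → ℂ} (hc : SepHol r₁ r₂ c) :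
    SepHol r₁ r₂ fun t z => deriv (c t) z where
  right t ht := (hc.right t ht).deriv isOpen_ball
  bdd s₁ hs₁ s₂ hs₂ := by
    obtain ⟨s, hs, hs'⟩ := exists_between hs₂
    obtain ⟨M, hM⟩ := hc.bdd s₁ hs₁ s hs'
    refine ⟨M / (s - s₂), fun t z ht hz => ?_⟩
    have hsub : closedBall z (s - s₂) ⊆ closedBall 0 s :=
      closedBall_subset_closedBall' (by rw [dist_zero_right]; linarith)
    have hsub' : closedBall z (s - s₂) ⊆ ball 0 r₂ :=
      hsub.trans (closedBall_subset_ball hs')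
    refine Complex.norm_deriv_le_of_forall_mem_sphere_norm_le (sub_pos.mpr hs) ?_ fun w hw => ?_
    · exact ((hc.right t (by simpa using ht.trans_lt hs₁)).mono hsub').diffContOnCl_ball le_rfl
    · exact hM t w ht (by simpa using hsub (sphere_subset_closedBall hw))
  left z hz := by
    rw [mem_ball_zero_iff] at hz
    obtain ⟨s₂, hs₂, hs₂'⟩ := exists_between hz
    have hδ : 0 < s₂ - ‖z‖ := sub_pos.mpr hs₂
    have hsmall : ∀ᶠ h : ℂ in 𝓝[≠] 0, h ≠ 0 ∧ ‖h‖ < s₂ - ‖z‖ :=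
      eventually_mem_nhdsWithin.and (nhdsWithin_le_nhds
        (Filter.mem_of_superset (ball_mem_nhds (0 : ℂ) hδ) fun h hh => by simpa using hh))
    have hlim : TendstoLocallyUniformlyOn (fun h t => h⁻¹ * (c t (z + h) - c t z))
        (fun t => deriv (c t) z) (𝓝[≠] 0) (ball 0 r₁) := by
      rw [Metric.tendstoLocallyUniformlyOn_iff]
      intro ε hε x hx
      obtain ⟨s₁, hs₁, hs₁'⟩ := exists_between (mem_ball_zero_iff.mp hx)
      obtain ⟨M, hM⟩ := hc.bdd s₁ hs₁' s₂ hs₂'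
      refine ⟨ball 0 s₁, mem_nhdsWithin_of_mem_nhds (isOpen_ball.mem_nhds (by simpa)), ?_⟩
      set C := 2 * (2 * M / (s₂ - ‖z‖)) / (s₂ - ‖z‖)
      have htend : Tendsto (fun h : ℂ => C * ‖h‖) (𝓝[≠] 0) (𝓝 0) := by
        have : Tendsto (fun h : ℂ => C * ‖h‖) (𝓝 0) (𝓝 (C * ‖(0 : ℂ)‖)) :=
          (continuous_const.mul continuous_norm).tendsto 0
        simpa using this.mono_left nhdsWithin_le_nhds
      filter_upwards [hsmall, htend.eventually (gt_mem_nhds hε)] with h hh hh' t ht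
      rw [mem_ball_zero_iff] at ht
      rw [dist_comm, dist_eq_norm]
      refine lt_of_le_of_lt (norm_slope_sub_deriv_le ?_ (fun w hw => ?_) hh.1 hh.2) hh'
      · refine (hc.right t (by simpa using ht.trans hs₁')).mono ?_
        exact ball_subset_ball' (by rw [dist_zero_right]; linarith)
      · refine hM t w ht.le ?_
        have : w ∈ ball (0 : ℂ) s₂ :=
          ball_subset_ball' (by rw [dist_zero_right]; linarith) hw
        exact (mem_ball_zero_iff.mp this).le
    refine hlim.differentiableOn ?_ isOpen_ball
    filter_upwards [hsmall] with h hh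
    refine ((hc.left (z + h) ?_).sub (hc.left z (by simpa using hz))).const_mul _
    rw [mem_ball_zero_iff]
    linarith [norm_add_le z h, hh.2]

theorem SepHol.iteratedDeriv_right {r₁ r₂ : ℝ} {c : ℂ → ℂ → ℂ} (hc : SepHol r₁ r₂ c) (n : ℕ) :
    SepHol r₁ r₂ fun t z => iteratedDeriv n (c t) z := by
  induction n with
  | zero => simpa using hc
  | succ n ih =>
    simp_rw [iteratedDeriv_succ]
    exact ih.deriv_right

theorem norm_iteratedDeriv_le_of_bounded {f : ℂ → ℂ} {z : ℂ} {r s M R' : ℝ} (hr : 0 < r)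
    (hf : DifferentiableOn ℂ f (ball 0 R')) (hs : s < R') (hM : ∀ w, ‖w‖ ≤ s → ‖f w‖ ≤ M)
    (hz : ‖z‖ + r ≤ s) (n : ℕ) : ‖iteratedDeriv n f z‖ ≤ n ! * M / r ^ n := by
  have hsub : closedBall z r ⊆ closedBall 0 s :=
    closedBall_subset_closedBall' (by rw [dist_zero_right]; linarith)
  refine Complex.norm_iteratedDeriv_le_of_forall_mem_sphere_norm_le n hr ?_ fun w hw => ?_
  · exact (hf.mono (hsub.trans (closedBall_subset_ball hs))).diffContOnCl_ball le_rfl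
  · exact hM w (by simpa using hsub (sphere_subset_closedBall hw))

theorem SepHol.norm_iteratedDeriv_iteratedDeriv_le {R' R r s M : ℝ} {c : ℂ → ℂ → ℂ}
    (hc : SepHol R' R' c) (hr : 0 < r) (hs : R + r ≤ s) (hs' : s < R')
    (hM : ∀ t z, ‖t‖ ≤ s → ‖z‖ ≤ s → ‖c t z‖ ≤ M) (k n : ℕ) {t z : ℂ} (ht : ‖t‖ < R)
    (hz : ‖z‖ < R) :
    ‖iteratedDeriv k (fun t => iteratedDeriv n (c t) z) t‖ ≤ k ! * (n ! * M / r ^ n) / r ^ k := by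
  refine norm_iteratedDeriv_le_of_bounded (s := s) (R' := R') hr
    ((hc.iteratedDeriv_right n).left z (by rw [mem_ball_zero_iff]; linarith)) hs' (fun w hw => ?_)
    (by linarith) k
  exact norm_iteratedDeriv_le_of_bounded (s := s) (R' := R') hr
    (hc.right w (by rw [mem_ball_zero_iff]; linarith)) hs' (fun v hv => hM w v hw hv)
    (by linarith) n

theorem sepHol_of_differentiableOn {r₁ r₂ : ℝ} {c : ℂ → ℂ → ℂ}
    (hc : DifferentiableOn ℂ (fun q : ℂ × ℂ => c q.1 q.2) (ball 0 r₁ ×ˢ ball 0 r₂)) :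
    SepHol r₁ r₂ c where
  left z hz := hc.comp (f := fun t : ℂ => (t, z)) (by fun_prop) fun t ht => ⟨ht, hz⟩
  right t ht := hc.comp (f := fun z : ℂ => (t, z)) (by fun_prop) fun z hz => ⟨ht, hz⟩
  bdd s₁ hs₁ s₂ hs₂ := by
    have hK : IsCompact (closedBall (0 : ℂ) s₁ ×ˢ closedBall (0 : ℂ) s₂) :=
      (isCompact_closedBall _ _).prod (isCompact_closedBall _ _)
    obtain ⟨M, hM⟩ := hK.exists_bound_of_continuousOn (hc.continuousOn.mono
      (Set.prod_mono (closedBall_subset_ball hs₁) (closedBall_subset_ball hs₂)))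
    exact ⟨M, fun t z ht hz => hM (t, z) ⟨by simpa using ht, by simpa using hz⟩⟩

end InfVar
end

noncomputable section
namespace InfVar

open Var Finset
open scoped ENNReal

/-! ### Majorant series of polynomials in the `u_h` with holomorphic coefficients -/

/-- The polynomial `∑_i a_i c_i(v₀,v₁) ∏_{h<N} u_h^{e_{i,h}}`. -/
def polyFn {ι : Type*} (s : Finset ι) (a : ι → ℂ) (c : ι → ℂ → ℂ → ℂ) (e : ι → ℕ → ℕ) (N : ℕ) :
    (Var → ℂ) → ℂ :=
  fun x => ∑ i ∈ s, a i * c i (x V0) (x V1) * ∏ h ∈ range N, x (U h) ^ e i h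

/-- The points with `|v₀|, |v₁| < R'`. -/
def vDomain (R' : ℝ) : Set (Var → ℂ) := {x | ‖x V0‖ < R' ∧ ‖x V1‖ < R'}

section Poly

variable {ι : Type*} {s : Finset ι} {c : ι → ℂ → ℂ → ℂ} {N : ℕ} {R' : ℝ}

theorem prod_update_U (x : Var → ℂ) (e : ℕ → ℕ) {h : ℕ} (hh : h < N) (y : ℂ) :
    ∏ k ∈ range N, Function.update x (U h) y (U k) ^ e k =
      y ^ e h * ∏ k ∈ (range N).erase h, x (U k) ^ e k := by
  rw [← mul_prod_erase _ _ (mem_range.mpr hh), Function.update_self]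
  congr 1
  refine prod_congr rfl fun k hk => ?_
  rw [Function.update_of_ne]
  simpa using (mem_erase.mp hk).1

theorem partialD_U_polyFn {f : (Var → ℂ) → ℂ} {a : ι → ℂ} {e : ι → ℕ → ℕ}
    (hf : Set.EqOn f (polyFn s a c e N) (vDomain R')) {h : ℕ} (hh : h < N) :
    Set.EqOn (partialD (U h) f)
      (polyFn s (fun i => (e i h : ℂ) * a i) c
        (fun i => Function.update (e i) h (e i h - 1)) N) (vDomain R') := by
  intro x hx
  have h₁ : (fun y : ℂ => f (Function.update x (U h) y)) = fun y =>
      ∑ i ∈ s, a i * c i (x V0) (x V1) *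
        (y ^ e i h * ∏ k ∈ (range N).erase h, x (U k) ^ e i k) := by
    funext y
    rw [hf (by simpa [vDomain] using hx)]
    simp [polyFn, prod_update_U x _ hh]
  have h₂ : ∀ i, HasDerivAt (fun y : ℂ => a i * c i (x V0) (x V1) *
      (y ^ e i h * ∏ k ∈ (range N).erase h, x (U k) ^ e i k))
      (a i * c i (x V0) (x V1) * ((e i h : ℂ) * x (U h) ^ (e i h - 1) *
        ∏ k ∈ (range N).erase h, x (U k) ^ e i k)) (x (U h)) := fun i =>
    ((hasDerivAt_pow _ _).mul_const _).const_mul _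
  rw [partialD, h₁, (HasDerivAt.fun_sum fun i _ => h₂ i).deriv]
  refine sum_congr rfl fun i _ => ?_
  rw [← mul_prod_erase (range N) _ (mem_range.mpr hh)]
  dsimp only
  rw [Function.update_self]
  have : ∏ k ∈ (range N).erase h, x (U k) ^ Function.update (e i) h (e i h - 1) k =
      ∏ k ∈ (range N).erase h, x (U k) ^ e i k :=
    prod_congr rfl fun k hk => by rw [Function.update_of_ne (mem_erase.mp hk).1]
  rw [this]
  ring

theorem partialD_U_iterate_polyFn {f : (Var → ℂ) → ℂ} {a : ι → ℂ} {e : ι → ℕ → ℕ}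
    (hf : Set.EqOn f (polyFn s a c e N) (vDomain R')) {h : ℕ} (hh : h < N) (k : ℕ) :
    Set.EqOn ((partialD (U h))^[k] f)
      (polyFn s (fun i => ((e i h).descFactorial k : ℂ) * a i) c
        (fun i => Function.update (e i) h (e i h - k)) N) (vDomain R') := by
  induction k with
  | zero => simpa using hf
  | succ k ih =>
    rw [Function.iterate_succ_apply']
    refine (partialD_U_polyFn ih hh).trans fun x _ => ?_
    simp only [polyFn, Function.update_self, Function.update_idem, Nat.descFactorial_succ,
      Nat.cast_mul, Nat.sub_sub, mul_assoc]

theorem uDeriv_polyFn (l : ℕ → ℕ) (M : ℕ) : ∀ {f : (Var → ℂ) → ℂ} {a : ι → ℂ}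
    {e : ι → ℕ → ℕ} (_ : Set.EqOn f (polyFn s a c e N) (vDomain R')) (_ : M ≤ N),
    Set.EqOn (uDeriv l M f)
      (polyFn s (fun i => (∏ h ∈ range M, ((e i h).descFactorial (l h) : ℂ)) * a i) c
        (fun i h => if h < M then e i h - l h else e i h) N) (vDomain R') := by
  induction M with
  | zero => intro f a e hf _; simpa [uDeriv] using hf
  | succ M ih =>
    intro f a e hf hM
    rw [uDeriv]
    refine (ih (partialD_U_iterate_polyFn hf (by omega) (l M)) (by omega)).trans fun x _ => ?_
    refine sum_congr rfl fun i _ => ?_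
    have h₁ : ∏ h ∈ range M, ((Function.update (e i) M (e i M - l M) h).descFactorial (l h) : ℂ) =
        ∏ h ∈ range M, ((e i h).descFactorial (l h) : ℂ) :=
      prod_congr rfl fun h hh => by rw [Function.update_of_ne (mem_range.mp hh).ne]
    have h₂ : ∀ h, (if h < M then Function.update (e i) M (e i M - l M) h - l h
        else Function.update (e i) M (e i M - l M) h) =
        if h < M + 1 then e i h - l h else e i h := by
      intro h
      rcases lt_trichotomy h M with hlt | rfl | hgt
      · rw [if_pos hlt, if_pos (by omega), Function.update_of_ne hlt.ne]
      · simp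
      · rw [if_neg (by omega), if_neg (by omega), Function.update_of_ne hgt.ne']
    simp only [h₁, h₂, prod_range_succ]
    ring

/-- The identities hold only on the open set `vDomain R'`, so each further derivative is taken
through an eventual equality near the point. -/
theorem partialD_V_iterate_polyFn {f : (Var → ℂ) → ℂ} {a : ι → ℂ} {e : ι → ℕ → ℕ}
    (hc : ∀ i ∈ s, SepHol R' R' (c i))
    (hf : Set.EqOn f (polyFn s a c e N) (vDomain R')) (k n : ℕ) :
    Set.EqOn ((partialD V0)^[k] ((partialD V1)^[n] f))
      (polyFn s a (fun i t z => iteratedDeriv k (fun t => iteratedDeriv n (c i t) z) t) e N)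
      (vDomain R') := by
  have h₁ : ∀ n, Set.EqOn ((partialD V1)^[n] f)
      (polyFn s a (fun i t z => iteratedDeriv n (c i t) z) e N) (vDomain R') := by
    intro n
    induction n with
    | zero => simpa using hf
    | succ n ih =>
      intro x hx
      rw [Function.iterate_succ_apply', partialD]
      have hev : (fun y => (partialD V1)^[n] f (Function.update x V1 y)) =ᶠ[nhds (x V1)]
          fun y => ∑ i ∈ s, a i * iteratedDeriv n (c i (x V0)) y *
            ∏ h ∈ range N, x (U h) ^ e i h := by
        filter_upwards [Metric.isOpen_ball.mem_nhds (mem_ball_zero_iff.mpr hx.2)] with y hy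
        rw [ih (by simpa [vDomain] using And.intro hx.1 (mem_ball_zero_iff.mp hy))]
        simp [polyFn]
      rw [hev.deriv_eq, (HasDerivAt.fun_sum fun i hi => ((HasDerivAt.const_mul (a i)
        (((hc i hi).iteratedDeriv_right n).right (x V0) (by simpa using hx.1)
        |>.hasDerivAt (Metric.isOpen_ball.mem_nhds (mem_ball_zero_iff.mpr hx.2)))).mul_const
        (∏ h ∈ range N, x (U h) ^ e i h))).deriv]
      simp only [polyFn, iteratedDeriv_succ]
  induction k with
  | zero => simpa using h₁ n
  | succ k ih =>
    intro x hx
    rw [Function.iterate_succ_apply', partialD]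
    have hev : (fun y => (partialD V0)^[k] ((partialD V1)^[n] f) (Function.update x V0 y))
        =ᶠ[nhds (x V0)] fun y => ∑ i ∈ s, a i *
          iteratedDeriv k (fun t => iteratedDeriv n (c i t) (x V1)) y *
          ∏ h ∈ range N, x (U h) ^ e i h := by
      filter_upwards [Metric.isOpen_ball.mem_nhds (mem_ball_zero_iff.mpr hx.1)] with y hy
      rw [ih (by simpa [vDomain] using And.intro (mem_ball_zero_iff.mp hy) hx.2)]
      simp [polyFn]
    have hd : ∀ i ∈ s, DifferentiableOn ℂ
        (iteratedDeriv k fun t => iteratedDeriv n (c i t) (x V1)) (Metric.ball 0 R') :=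
      fun i hi => by
      have := ((hc i hi).iteratedDeriv_right n).left (x V1) (by simpa using hx.2)
      clear hev ih
      induction k with
      | zero => simpa using this
      | succ k ih => rw [iteratedDeriv_succ]; exact ih.deriv Metric.isOpen_ball
    rw [hev.deriv_eq, (HasDerivAt.fun_sum fun i hi => ((HasDerivAt.const_mul (a i)
      ((hd i hi).hasDerivAt (Metric.isOpen_ball.mem_nhds
        (mem_ball_zero_iff.mpr hx.1)))).mul_const (∏ h ∈ range N, x (U h) ^ e i h))).deriv]
    simp only [polyFn, iteratedDeriv_succ]

theorem mixedD_polyFn {f : (Var → ℂ) → ℂ} {a : ι → ℂ} {e : ι → ℕ → ℕ} {α : ℕ}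
    (hc : ∀ i ∈ s, SepHol R' R' (c i))
    (hf : Set.EqOn f (polyFn s a c e (α + 1)) (vDomain R')) (n : Var →₀ ℕ) {x : Var → ℂ}
    (hx : x ∈ vDomain R') :
    mixedD α n f x = ∑ i ∈ s,
      (∏ h ∈ range (α + 1), ((e i h).descFactorial (n (U h)) : ℂ)) * a i *
      iteratedDeriv (n V0) (fun t => iteratedDeriv (n V1) (c i t) (x V1)) (x V0) *
      ∏ h ∈ range (α + 1), x (U h) ^ (e i h - n (U h)) := by
  rw [mixedD, partialD_V_iterate_polyFn hc (uDeriv_polyFn _ _ hf le_rfl) _ _ hx]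
  refine sum_congr rfl fun i _ => ?_
  congr 1
  refine prod_congr rfl fun h hh => ?_
  simp only [if_pos (mem_range.mp hh)]

/-- The variables `V₀, V₁, (U_h)_{h ∈ I(α)}`. -/
def varsFinset (α : ℕ) : Finset Var := insert V0 (insert V1 ((range (α + 1)).image U))

theorem subset_varsUpTo_iff {α : ℕ} {n : Var →₀ ℕ} :
    (n.support : Set Var) ⊆ varsUpTo α ↔ n.support ⊆ varsFinset α := by
  rw [← Finset.coe_subset]
  have : (varsFinset α : Set Var) = varsUpTo α := by
    ext i
    simp [varsFinset, varsUpTo, or_assoc]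
  rw [this]

theorem prod_varsFinset {M : Type*} [CommMonoid M] (α : ℕ) (g : Var → M) :
    ∏ i ∈ varsFinset α, g i = g V0 * (g V1 * ∏ h ∈ range (α + 1), g (U h)) := by
  rw [varsFinset, prod_insert (by simp), prod_insert (by simp), prod_image (by simp)]

theorem finsupp_prod_eq {M : Type*} [CommMonoid M] {α : ℕ} {n : Var →₀ ℕ}
    (hn : n.support ⊆ varsFinset α) {g : Var → ℕ → M} (hg : ∀ i, g i 0 = 1) :
    n.prod g = g V0 (n V0) * (g V1 (n V1) * ∏ h ∈ range (α + 1), g (U h) (n (U h))) := by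
  rw [Finsupp.prod_of_support_subset n hn g fun i _ => hg i, prod_varsFinset]

/-- A finite set of multi-indices supported in `S` embeds, by restriction to `S`, into a box of
functions on `S`; the sum over a box is a product of sums. -/
theorem tsum_finsupp_prod_le {κ : Type*} [DecidableEq κ] (S : Finset κ) (g : κ → ℕ → ℝ≥0∞) :
    ∑' n : κ →₀ ℕ, (if n.support ⊆ S then ∏ i ∈ S, g i (n i) else 0) ≤
      ∏ i ∈ S, ∑' k, g i k := by
  rw [ENNReal.tsum_eq_iSup_sum]
  refine iSup_le fun T => ?_
  rw [← sum_filter]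
  set K := (T.sup fun n => n.degree) + 1
  have hK : ∀ n ∈ T, ∀ i, n i < K := fun n hn i => Nat.lt_succ_of_le
    ((Finsupp.le_degree i n).trans (Finset.le_sup (f := fun n : κ →₀ ℕ => n.degree) hn))
  calc ∑ n ∈ T with n.support ⊆ S, ∏ i ∈ S, g i (n i)
      ≤ ∑ p ∈ Fintype.piFinset fun _ : S => range K, ∏ i : S, g i (p i) := by
        have hinj : Set.InjOn (fun (n : κ →₀ ℕ) (i : S) => n i)
            ({n ∈ T | n.support ⊆ S} : Finset (κ →₀ ℕ)) := by
          intro n hn m hm hnm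
          ext i
          by_cases hi : i ∈ S
          · exact congrFun hnm ⟨i, hi⟩
          · have h₁ := fun h => hi ((mem_filter.mp hn).2 h)
            have h₂ := fun h => hi ((mem_filter.mp hm).2 h)
            rw [Finsupp.notMem_support_iff.mp h₁, Finsupp.notMem_support_iff.mp h₂]
        calc _ = ∑ n ∈ T with n.support ⊆ S, ∏ i : S, g i (n i) :=
              sum_congr rfl fun n _ => (prod_coe_sort S fun i => g i (n i)).symm
          _ = ∑ p ∈ ({n ∈ T | n.support ⊆ S}).image fun (n : κ →₀ ℕ) (i : S) => n i,
              ∏ i : S, g i (p i) := (sum_image (f := fun p : S → ℕ => ∏ i : S, g i (p i)) hinj).symm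
          _ ≤ _ := by
              refine sum_le_sum_of_subset fun p hp => ?_
              obtain ⟨n, hn, rfl⟩ := mem_image.mp hp
              simp only [Fintype.mem_piFinset, mem_range]
              exact fun i => hK n (mem_filter.mp hn).1 i
    _ = ∏ i : S, ∑ k ∈ range K, g i k := (prod_univ_sum _ _).symm
    _ ≤ ∏ i : S, ∑' k, g i k := prod_le_prod' fun i _ => ENNReal.sum_le_tsum _
    _ = ∏ i ∈ S, ∑' k, g i k := prod_coe_sort S fun i => ∑' k, g i k

end Poly

/-! ### Norms of majorant series -/

theorem coeff_majorantSeries_of_subset (R ρ : ℝ) {α : ℕ} (f : (Var → ℂ) → ℂ) {n : Var →₀ ℕ}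
    (hn : (n.support : Set Var) ⊆ varsUpTo α) :
    MvPowerSeries.coeff n (majorantSeries R ρ α f) =
      ((supD R ρ α n f / multiFactorial n : ℝ) : ℂ) := if_pos hn

theorem coeff_majorantSeries_of_not_subset (R ρ : ℝ) {α : ℕ} (f : (Var → ℂ) → ℂ)
    {n : Var →₀ ℕ} (hn : ¬(n.support : Set Var) ⊆ varsUpTo α) :
    MvPowerSeries.coeff n (majorantSeries R ρ α f) = 0 := if_neg hn

theorem supD_nonneg (R ρ : ℝ) (α : ℕ) (n : Var →₀ ℕ) (f : (Var → ℂ) → ℂ) :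
    0 ≤ supD R ρ α n f :=
  Real.sSup_nonneg (by rintro _ ⟨x, _, rfl⟩; exact norm_nonneg _)

theorem supD_le {R ρ : ℝ} {α : ℕ} {n : Var →₀ ℕ} {f : (Var → ℂ) → ℂ} {C : ℝ} (hC : 0 ≤ C)
    (h : ∀ x ∈ polydisc R ρ α, ‖mixedD α n f x‖ ≤ C) : supD R ρ α n f ≤ C :=
  Real.sSup_le (by rintro _ ⟨x, hx, rfl⟩; exact h x hx) hC

/-- The bound `‖∂_{v₀}^k ∂_{v₁}^n c‖ V₀^k V₁^n ≤ k! n! M x^{k+n}` on the bidisc of radius `R`. -/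
def DerivBound (R r₀ r₁ x M : ℝ) (c : ℂ → ℂ → ℂ) : Prop :=
  ∀ k n : ℕ, ∀ t z : ℂ, ‖t‖ < R → ‖z‖ < R →
    ‖iteratedDeriv k (fun t => iteratedDeriv n (c t) z) t‖ * (r₀ ^ k * r₁ ^ n) ≤
      (k ! * n ! : ℝ) * (M * x ^ (k + n))

theorem tsum_ofReal_choose_mul_pow {ρ y : ℝ} (hρ : 0 ≤ ρ) (hy : 0 ≤ y) (m : ℕ) :
    ∑' k, ENNReal.ofReal ((m.choose k : ℝ) * ρ ^ (m - k) * y ^ k) =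
      ENNReal.ofReal ((ρ + y) ^ m) := by
  rw [tsum_eq_sum (s := range (m + 1)), ← ENNReal.ofReal_sum_of_nonneg, add_comm ρ y, add_pow]
  · congr 1
    exact sum_congr rfl fun k _ => by ring
  · intro k _; positivity
  · intro k hk
    rw [Nat.choose_eq_zero_of_lt (by simpa using hk)]
    simp

theorem tsum_ofReal_pow {x : ℝ} (hx : 0 ≤ x) (hx₁ : x < 1) :
    ∑' k : ℕ, ENNReal.ofReal (x ^ k) = ENNReal.ofReal (1 - x)⁻¹ := by
  rw [← ENNReal.ofReal_tsum_of_nonneg (fun k => by positivity)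
    (summable_geometric_of_lt_one hx hx₁), tsum_geometric_of_lt_one hx hx₁]

/-- The coefficients of a series that dominates the majorant series of `∏_h u_h^{e_h}` times a
holomorphic function of `v₀, v₁`. -/
def domCoeff (x ρ : ℝ) (r : Var → ℝ) (e : ℕ → ℕ) : Var → ℕ → ℝ
  | V0, k => x ^ k
  | V1, k => x ^ k
  | U h, k => ((e h).choose k : ℝ) * ρ ^ (e h - k) * r (U h) ^ k

theorem domCoeff_nonneg {x ρ : ℝ} {r : Var → ℝ} (hx : 0 ≤ x) (hρ : 0 ≤ ρ) (hr : ∀ i, 0 < r i)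
    (e : ℕ → ℕ) (i : Var) (k : ℕ) : 0 ≤ domCoeff x ρ r e i k := by
  cases i with
  | V0 => exact pow_nonneg hx _
  | V1 => exact pow_nonneg hx _
  | U h => have := hr (U h); simp only [domCoeff]; positivity

/-- Each monomial contributes `e.descFactorial l = l! * e.choose l`; the factorial cancels against
that of the multi-index and leaves binomial terms in `ρ` and `r (U h)`. The case `l > e` is harmless
because the falling factorial vanishes. -/
theorem supD_polyFn_mul_le {ι : Type*} {s : Finset ι} {f : (Var → ℂ) → ℂ} {a : ι → ℂ}
    {c : ι → ℂ → ℂ → ℂ} {e : ι → ℕ → ℕ} {α : ℕ} {R R' ρ x : ℝ} {r : Var → ℝ} {M : ι → ℝ}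
    (hRR' : R < R') (hr : ∀ i, 0 < r i) (hρ : 0 ≤ ρ) (hx : 0 ≤ x)
    (hc : ∀ i ∈ s, SepHol R' R' (c i)) (hM₀ : ∀ i ∈ s, 0 ≤ M i)
    (hM : ∀ i ∈ s, DerivBound R (r V0) (r V1) x (M i) (c i))
    (hf : Set.EqOn f (polyFn s a c e (α + 1)) (vDomain R')) {n : Var →₀ ℕ}
    (hn : n.support ⊆ varsFinset α) :
    supD R ρ α n f / multiFactorial n * monom r n ≤
      ∑ i ∈ s, ‖a i‖ * M i * ∏ v ∈ varsFinset α, domCoeff x ρ r (e i) v (n v) := by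
  have hmono := monom_pos hr n
  have hfac : (0 : ℝ) < multiFactorial n := Nat.cast_pos.mpr (multiFactorial_pos n)
  have hfac_eq : (multiFactorial n : ℝ) =
      (n V0)! * ((n V1)! * ∏ h ∈ range (α + 1), ((n (U h))! : ℝ)) := by
    rw [multiFactorial, finsupp_prod_eq hn (fun _ => rfl)]
    push_cast
    rfl
  have hmono_eq : monom r n =
      r V0 ^ n V0 * (r V1 ^ n V1 * ∏ h ∈ range (α + 1), r (U h) ^ n (U h)) :=
    finsupp_prod_eq hn fun _ => pow_zero _
  have hsum_nonneg : 0 ≤ ∑ i ∈ s, ‖a i‖ * M i *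
      ∏ v ∈ varsFinset α, domCoeff x ρ r (e i) v (n v) :=
    sum_nonneg fun i hi => mul_nonneg (mul_nonneg (norm_nonneg _) (hM₀ i hi))
      (prod_nonneg fun v _ => domCoeff_nonneg hx hρ hr _ _ _)
  suffices h : supD R ρ α n f ≤ (∑ i ∈ s, ‖a i‖ * M i *
      ∏ v ∈ varsFinset α, domCoeff x ρ r (e i) v (n v)) * multiFactorial n / monom r n by
    rw [le_div_iff₀ hmono] at h
    rw [div_mul_eq_mul_div, div_le_iff₀ hfac]
    exact h
  refine supD_le (by positivity) fun y hy => ?_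
  have hy' : y ∈ vDomain R' := ⟨hy.1.trans hRR', hy.2.1.trans hRR'⟩
  rw [mixedD_polyFn hc hf n hy', sum_mul, sum_div]
  refine (norm_sum_le _ _).trans (sum_le_sum fun i hi => ?_)
  rw [le_div_iff₀ hmono]
  have hu : ‖∏ h ∈ range (α + 1), y (U h) ^ (e i h - n (U h))‖ ≤
      ∏ h ∈ range (α + 1), ρ ^ (e i h - n (U h)) := by
    rw [norm_prod]
    refine prod_le_prod (fun _ _ => norm_nonneg _) fun h hh => ?_
    rw [norm_pow]
    gcongr
    exact (hy.2.2 h (Nat.lt_succ_iff.mp (mem_range.mp hh))).le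
  have hB := hM i hi (n V0) (n V1) (y V0) (y V1) hy.1 hy.2.1
  have hB₀ : 0 ≤ ‖iteratedDeriv (n V0) (fun t => iteratedDeriv (n V1) (c i t) (y V1)) (y V0)‖ *
      (r V0 ^ n V0 * r V1 ^ n V1) := by
    have := hr V0
    have := hr V1
    positivity
  have hrpos : 0 < ∏ h ∈ range (α + 1), r (U h) ^ n (U h) := prod_pos fun h _ => pow_pos (hr _) _
  calc _ = ‖a i‖ * (∏ h ∈ range (α + 1), ((e i h).descFactorial (n (U h)) : ℝ)) *
        ‖∏ h ∈ range (α + 1), y (U h) ^ (e i h - n (U h))‖ *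
        (∏ h ∈ range (α + 1), r (U h) ^ n (U h)) *
        (‖iteratedDeriv (n V0) (fun t => iteratedDeriv (n V1) (c i t) (y V1)) (y V0)‖ *
          (r V0 ^ n V0 * r V1 ^ n V1)) := by
        rw [hmono_eq, norm_mul, norm_mul, norm_mul, norm_prod (range (α + 1)) fun h =>
          ((e i h).descFactorial (n (U h)) : ℂ)]
        simp only [Complex.norm_natCast]
        ring
    _ ≤ ‖a i‖ * (∏ h ∈ range (α + 1), ((e i h).descFactorial (n (U h)) : ℝ)) *
        (∏ h ∈ range (α + 1), ρ ^ (e i h - n (U h))) *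
        (∏ h ∈ range (α + 1), r (U h) ^ n (U h)) *
        (((n V0)! * (n V1)! : ℝ) * (M i * x ^ (n V0 + n V1))) := by gcongr
    _ = _ := by
        rw [prod_varsFinset, hfac_eq]
        simp only [domCoeff, Nat.descFactorial_eq_factorial_mul_choose, Nat.cast_mul,
          prod_mul_distrib, pow_add]
        ring

/-- The dominating coefficients are products over the variables, so their sum factorises: a
geometric series for each of `V₀, V₁`, and the binomial theorem for each `U_h`. -/
theorem wNorm_majorantSeries_le {ι : Type*} {s : Finset ι} {f : (Var → ℂ) → ℂ} {a : ι → ℂ}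
    {c : ι → ℂ → ℂ → ℂ} {e : ι → ℕ → ℕ} {α : ℕ} {R R' ρ x : ℝ} {r : Var → ℝ} {M : ι → ℝ}
    (hRR' : R < R') (hr : ∀ i, 0 < r i) (hρ : 0 ≤ ρ) (hx : 0 ≤ x) (hx₁ : x < 1)
    (hc : ∀ i ∈ s, SepHol R' R' (c i)) (hM₀ : ∀ i ∈ s, 0 ≤ M i)
    (hM : ∀ i ∈ s, DerivBound R (r V0) (r V1) x (M i) (c i))
    (hf : Set.EqOn f (polyFn s a c e (α + 1)) (vDomain R')) :
    wNorm (monom r) (majorantSeries R ρ α f) ≤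
      ENNReal.ofReal (∑ i ∈ s, ‖a i‖ * M i *
        ((1 - x)⁻¹ * ((1 - x)⁻¹ * ∏ h ∈ range (α + 1), (ρ + r (U h)) ^ e i h))) := by
  have h1x : 0 < (1 - x)⁻¹ := inv_pos.mpr (by linarith)
  have hd := fun i => domCoeff_nonneg hx hρ hr (e i)
  have hterm : ∀ n : Var →₀ ℕ,
      ‖MvPowerSeries.coeff n (majorantSeries R ρ α f)‖ₑ * ENNReal.ofReal (monom r n) ≤
      ∑ i ∈ s, ENNReal.ofReal (‖a i‖ * M i) * (if n.support ⊆ varsFinset α then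
        ∏ v ∈ varsFinset α, ENNReal.ofReal (domCoeff x ρ r (e i) v (n v)) else 0) := by
    intro n
    by_cases hn : n.support ⊆ varsFinset α
    · rw [coeff_majorantSeries_of_subset _ _ _ (subset_varsUpTo_iff.mpr hn)]
      simp only [if_pos hn]
      rw [← ofReal_norm, Complex.norm_real, Real.norm_of_nonneg
        (div_nonneg (supD_nonneg _ _ _ _ _) (Nat.cast_nonneg _)), ← ENNReal.ofReal_mul
        (div_nonneg (supD_nonneg _ _ _ _ _) (Nat.cast_nonneg _))]
      refine (ENNReal.ofReal_le_ofReal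
        (supD_polyFn_mul_le hRR' hr hρ hx hc hM₀ hM hf hn)).trans (le_of_eq ?_)
      rw [ENNReal.ofReal_sum_of_nonneg fun i hi => mul_nonneg
        (mul_nonneg (norm_nonneg _) (hM₀ i hi)) (prod_nonneg fun v _ => hd i v _)]
      refine sum_congr rfl fun i hi => ?_
      rw [ENNReal.ofReal_mul (mul_nonneg (norm_nonneg _) (hM₀ i hi)),
        ENNReal.ofReal_prod_of_nonneg fun v _ => hd i v _]
    · rw [coeff_majorantSeries_of_not_subset _ _ _ (mt subset_varsUpTo_iff.mp hn)]
      simp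
  unfold wNorm
  refine (ENNReal.tsum_le_tsum hterm).trans ?_
  rw [Summable.tsum_finsetSum fun _ _ => ENNReal.summable,
    ENNReal.ofReal_sum_of_nonneg fun i hi => mul_nonneg
      (mul_nonneg (norm_nonneg _) (hM₀ i hi)) (mul_nonneg h1x.le (mul_nonneg h1x.le
        (prod_nonneg fun h _ => pow_nonneg (add_nonneg hρ (hr _).le) _)))]
  refine sum_le_sum fun i hi => ?_
  rw [ENNReal.tsum_mul_left, ENNReal.ofReal_mul (mul_nonneg (norm_nonneg _) (hM₀ i hi))]
  gcongr
  refine (tsum_finsupp_prod_le (varsFinset α)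
    fun v k => ENNReal.ofReal (domCoeff x ρ r (e i) v k)).trans (le_of_eq ?_)
  rw [prod_varsFinset, ENNReal.ofReal_mul h1x.le, ENNReal.ofReal_mul h1x.le,
    ENNReal.ofReal_prod_of_nonneg fun h _ => pow_nonneg (add_nonneg hρ (hr _).le) _]
  simp only [domCoeff, tsum_ofReal_pow hx hx₁, tsum_ofReal_choose_mul_pow hρ (hr _).le]

/-- Cauchy's inequality costs `(n+l)!/(s-R)^(n+l)`. Writing `(n+l)!` as `(n+l).choose n * n! * l!`,
the binomial coefficient is absorbed by one term of `(r₁ + 1/ν)^(n+l)`, whence the requirement that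
`r₁ + 1/ν` be at most `x * (s - R)`. The constant `l! ν^l` cancels the denominators in `A_j`, so the
bound does not deteriorate with `l`. -/
theorem derivBound_iteratedDeriv {R R' s x r₀ r₁ ν M : ℝ} {c : ℂ → ℂ → ℂ}
    (hc : SepHol R' R' c) (hs : R < s) (hs' : s < R') (hx : 0 ≤ x) (hx₁ : x < 1) (hν : 0 < ν)
    (hr₀ : 0 ≤ r₀) (hr₁ : 0 ≤ r₁) (h₀ : r₀ ≤ x * (s - R)) (h₁ : r₁ + 1 / ν ≤ x * (s - R))
    (hM₀ : 0 ≤ M) (hM : ∀ t z, ‖t‖ ≤ s → ‖z‖ ≤ s → ‖c t z‖ ≤ M) (l : ℕ) :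
    DerivBound R r₀ r₁ x (l ! * ν ^ l * M) fun t z => iteratedDeriv l (c t) z := by
  intro k n t z ht hz
  have hr : 0 < s - R := sub_pos.mpr hs
  have hcomp : ∀ t : ℂ, iteratedDeriv n (fun z => iteratedDeriv l (c t) z) =
      iteratedDeriv (n + l) (c t) := fun t => by
    simp only [iteratedDeriv_eq_iterate, Function.iterate_add_apply]
  simp only [hcomp]
  have hD := hc.norm_iteratedDeriv_iteratedDeriv_le (R := R) hr (by linarith) hs' hM k (n + l) ht hz
  have hbinom : ((n + l).choose n : ℝ) * (r₁ ^ n * (1 / ν) ^ l) ≤ (x * (s - R)) ^ (n + l) := by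
    refine le_trans ?_ (pow_le_pow_left₀ (by positivity) h₁ (n + l))
    rw [add_pow]
    refine le_trans (le_of_eq ?_) (single_le_sum (f := fun m => r₁ ^ m * (1 / ν) ^ (n + l - m) *
      ((n + l).choose m : ℝ)) (fun m _ => by positivity) (mem_range.mpr (by omega :
        n < n + l + 1)))
    simp only [Nat.add_sub_cancel_left]
    ring
  have hfac : ((n + l)! : ℝ) = (n + l).choose n * n ! * l ! := by
    have := Nat.choose_mul_factorial_mul_factorial (show n ≤ n + l by omega)
    rw [Nat.add_sub_cancel_left] at this
    exact_mod_cast this.symm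
  have hpow : x ^ (n + l) ≤ x ^ n := pow_le_pow_of_le_one hx hx₁.le (by omega)
  calc _ ≤ k ! * ((n + l)! * M / (s - R) ^ (n + l)) / (s - R) ^ k * (r₀ ^ k * r₁ ^ n) := by
        gcongr
    _ ≤ k ! * ((n + l)! * M / (s - R) ^ (n + l)) / (s - R) ^ k *
        ((x * (s - R)) ^ k * r₁ ^ n) := by gcongr
    _ = k ! * n ! * (l ! * ν ^ l * M) * x ^ k / (s - R) ^ (n + l) *
        (((n + l).choose n : ℝ) * (r₁ ^ n * (1 / ν) ^ l)) := by
        rw [hfac, mul_pow, one_div, inv_pow]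
        field_simp
    _ ≤ k ! * n ! * (l ! * ν ^ l * M) * x ^ k / (s - R) ^ (n + l) *
        (x * (s - R)) ^ (n + l) := by gcongr
    _ = k ! * n ! * (l ! * ν ^ l * M) * x ^ k * x ^ (n + l) := by
        rw [mul_pow]
        field_simp
    _ ≤ k ! * n ! * (l ! * ν ^ l * M) * x ^ k * x ^ n := by gcongr
    _ = _ := by rw [pow_add]; ring

/-! ### The majorants of `A_j` and `B_j` -/

theorem sepHol_const (r₁ r₂ : ℝ) (C : ℂ) : SepHol r₁ r₂ fun _ _ => C where
  left _ _ := differentiableOn_const C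
  right _ _ := differentiableOn_const C
  bdd _ _ _ _ := ⟨‖C‖, fun _ _ _ _ => le_rfl⟩

/-- The last `p` entries, each at most `j`, determine the first one through the sum. -/
theorem card_antidiagonalTuple_le (p j : ℕ) :
    #(Finset.Nat.antidiagonalTuple (p + 1) j) ≤ (j + 1) ^ p := by
  have hcard : #(Fintype.piFinset fun _ : Fin p => range (j + 1)) = (j + 1) ^ p := by simp
  rw [← hcard]
  refine card_le_card_of_injOn (fun t l => t l.succ) (fun t ht => ?_) fun t ht t' ht' h => ?_
  · have ht := Finset.Nat.mem_antidiagonalTuple.mp ht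
    simp only [Fintype.coe_piFinset, Set.mem_pi, Set.mem_univ, forall_const, coe_range,
      Set.mem_Iio]
    intro l
    have := single_le_sum (f := t) (fun _ _ => Nat.zero_le _) (mem_univ l.succ)
    omega
  · have ht := Finset.Nat.mem_antidiagonalTuple.mp ht
    have ht' := Finset.Nat.mem_antidiagonalTuple.mp ht'
    rw [Fin.sum_univ_succ] at ht ht'
    have hs : ∑ l : Fin p, t l.succ = ∑ l : Fin p, t' l.succ :=
      sum_congr rfl fun l _ => congrFun h l
    funext l
    refine Fin.cases ?_ (fun l => congrFun h l) l
    omega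

theorem prod_pow_card_fiber {M : Type*} [CommMonoid M] {p N : ℕ} (t : Fin p → ℕ)
    (ht : ∀ l, t l < N) (g : ℕ → M) :
    ∏ h ∈ range N, g h ^ #{l : Fin p | t l = h} = ∏ l, g (t l) := by
  rw [← prod_fiberwise_of_maps_to (s := univ) (t := range N) (g := t)
    fun l _ => mem_range.mpr (ht l)]
  refine prod_congr rfl fun h _ => ?_
  rw [prod_congr rfl fun l hl => by rw [(mem_filter.mp hl).2], prod_const]

theorem prod_pow_single {M : Type*} [CommMonoid M] {N m : ℕ} (hm : m < N) (g : ℕ → M) :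
    ∏ h ∈ range N, g h ^ (if h = m then 1 else 0) = g m := by
  rw [prod_eq_single_of_mem m (mem_range.mpr hm)]
  · simp
  · intro h _ hne
    simp [hne]

/-- The indices of the terms of `A_j`. -/
abbrev AIndex : Type := (ℕ × ℕ) ⊕ (Σ p : ℕ, Fin (p + 1) → ℕ)

/-- The indices of the terms of `A_j`, for given `d` and `j`. -/
def aIndices (d j : ℕ) : Finset AIndex :=
  (antidiagonal j).disjSum ((range (d + 1)).sigma fun p => Finset.Nat.antidiagonalTuple (p + 1) j)

/-- The constant factors of the terms of `A_j`. -/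
def aConst (ν : ℝ) : AIndex → ℂ
  | .inl l => ((l.2 : ℂ) + 1) * (ν : ℂ) / ((l.1 ! : ℂ) * (ν : ℂ) ^ l.1)
  | .inr t => 1 / (((t.2 0) ! : ℂ) * (ν : ℂ) ^ (t.2 0))

/-- The order of differentiation in the terms of `A_j`. -/
def aOrder : AIndex → ℕ
  | .inl l => l.1
  | .inr t => t.2 0

/-- The functions that are differentiated in the terms of `A_j`. -/
def aFun (a : ℂ → ℂ → ℂ) (ap : ℕ → ℂ → ℂ → ℂ) : AIndex → ℂ → ℂ → ℂ
  | .inl _ => a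
  | .inr t => ap t.1

/-- The exponents of the `u_h` in the terms of `A_j`. -/
def aExp : AIndex → ℕ → ℕ
  | .inl l, h => if h = l.2 + 1 then 1 else 0
  | .inr t, h => #{l : Fin t.1 | t.2 l.succ = h}

theorem le_of_mem_antidiagonalTuple {k j : ℕ} {t : Fin k → ℕ}
    (ht : t ∈ Finset.Nat.antidiagonalTuple k j) (l : Fin k) : t l ≤ j := by
  rw [← Finset.Nat.mem_antidiagonalTuple.mp ht]
  exact single_le_sum (f := t) (fun _ _ => Nat.zero_le _) (mem_univ l)

theorem funA_eq_polyFn (ν : ℝ) (d : ℕ) (a : ℂ → ℂ → ℂ) (ap : ℕ → ℂ → ℂ → ℂ) {j α : ℕ}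
    (hj : j ≤ α) : funA ν d a ap j = polyFn (aIndices d j) (aConst ν)
      (fun i t z => iteratedDeriv (aOrder i) (aFun a ap i t) z) aExp (α + 1 + 1) := by
  funext x
  rw [funA, polyFn, aIndices, sum_disjSum, sum_sigma]
  congr 1
  · refine sum_congr rfl fun l hl => ?_
    have := mem_antidiagonal.mp hl
    simp only [aExp, aConst, aOrder, aFun]
    rw [prod_pow_single (by omega) fun h => x (U h)]
    ring
  · refine sum_congr rfl fun p _ => sum_congr rfl fun t ht => ?_
    simp only [aExp, aConst, aOrder, aFun]
    rw [prod_pow_card_fiber (fun l : Fin p => t l.succ)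
      (fun l => by have := le_of_mem_antidiagonalTuple ht l.succ; omega) fun h => x (U h)]
    ring

section Majorants

variable {R R' s x ν ρ δ : ℝ} {r : Var → ℝ}

/-- Each term is bounded independently of the order of differentiation, so it remains to count. In
the first sum, at most `α + 1` terms carry a factor `l₂ + 1 ≤ α + 1`; in the second, each `p ≤ d`
gives at most `(α+1)^d` terms. Since `ρ ≥ 1`, each `ρ + r (U h)` is at most `(1 + δ) * ρ`. -/
theorem wNorm_majorantSeries_funA_le (hs : R < s) (hs' : s < R') (hx : 0 ≤ x) (hx₁ : x < 1)
    (hν : 0 < ν) (hr : ∀ i, 0 < r i) (h₀ : r V0 ≤ x * (s - R))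
    (h₁ : r V1 + 1 / ν ≤ x * (s - R)) (hδ : ∀ h, r (U h) ≤ δ) (hρ : 1 ≤ ρ) {d : ℕ} (hd : 2 ≤ d)
    {a : ℂ → ℂ → ℂ} {ap : ℕ → ℂ → ℂ → ℂ} (ha : SepHol R' R' a)
    (hap : ∀ p ≤ d, SepHol R' R' (ap p)) {M : ℝ} (hM₀ : 0 ≤ M)
    (hM : ∀ t z, ‖t‖ ≤ s → ‖z‖ ≤ s → ‖a t z‖ ≤ M)
    (hMp : ∀ p ≤ d, ∀ t z, ‖t‖ ≤ s → ‖z‖ ≤ s → ‖ap p t z‖ ≤ M) {j α : ℕ} (hj : j ≤ α) :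
    wNorm (monom r) (majorantSeries R ρ (α + 1) (funA ν d a ap j)) ≤
      ENNReal.ofReal (M * (1 - x)⁻¹ ^ 2 * (1 + δ) ^ d * (ν + d + 1) * ((α : ℝ) + 1) ^ d *
        ρ ^ d) := by
  have hδ₀ : 0 < δ := (hr (U 0)).trans_le (hδ 0)
  have hK : 0 < (1 - x)⁻¹ := inv_pos.mpr (by linarith)
  have hα : (1 : ℝ) ≤ (α : ℝ) + 1 := by linarith [(Nat.cast_nonneg α : (0 : ℝ) ≤ α)]
  have hjα : ((j : ℝ) + 1) ≤ α + 1 := by gcongr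
  have hu : ∀ h, ρ + r (U h) ≤ (1 + δ) * ρ := fun h => by nlinarith [hδ h]
  have hu₀ : ∀ h, 0 ≤ ρ + r (U h) := fun h => by linarith [hr (U h)]
  have hB : (1 : ℝ) ≤ (1 + δ) * ρ := by nlinarith
  have hmem : ∀ i ∈ aIndices d j, SepHol R' R' (aFun a ap i) ∧
      ∀ t z, ‖t‖ ≤ s → ‖z‖ ≤ s → ‖aFun a ap i t z‖ ≤ M := by
    rintro (l | t) hi
    · exact ⟨ha, hM⟩
    · have hp : t.1 ≤ d := by
        simpa [aIndices, Nat.lt_succ_iff] using (mem_sigma.mp (inr_mem_disjSum.mp hi)).1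
      exact ⟨hap _ hp, hMp _ hp⟩
  refine (wNorm_majorantSeries_le (hs.trans hs') hr (by linarith) hx hx₁
    (M := fun i => (aOrder i)! * ν ^ aOrder i * M)
    (fun i hi => (hmem i hi).1.iteratedDeriv_right _) (fun i _ => by positivity)
    (fun i hi => derivBound_iteratedDeriv (hmem i hi).1 hs hs' hx hx₁ hν (hr _).le (hr _).le h₀ h₁
      hM₀ (hmem i hi).2 _) fun y _ => congrFun (funA_eq_polyFn ν d a ap hj) y).trans
    (ENNReal.ofReal_le_ofReal ?_)
  rw [aIndices, sum_disjSum, sum_sigma]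
  have hA : ∀ l ∈ antidiagonal j, ‖aConst ν (.inl l)‖ *
      ((aOrder (.inl l))! * ν ^ aOrder (.inl l) * M) * ((1 - x)⁻¹ * ((1 - x)⁻¹ *
        ∏ h ∈ range (α + 1 + 1), (ρ + r (U h)) ^ aExp (.inl l) h)) ≤
      (α + 1) * ν * M * (1 - x)⁻¹ ^ 2 * ((1 + δ) * ρ) ^ d := by
    intro l hl
    have hl := mem_antidiagonal.mp hl
    have hl2 : (l.2 : ℝ) + 1 ≤ α + 1 := by
      have : (l.2 : ℝ) ≤ α := by exact_mod_cast (by omega : l.2 ≤ α)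
      linarith
    simp only [aExp]
    rw [prod_pow_single (by omega) fun h => ρ + r (U h)]
    have hn : ‖aConst ν (.inl l)‖ * ((aOrder (.inl l))! * ν ^ aOrder (.inl l) * M) =
        ((l.2 : ℝ) + 1) * ν * M := by
      have h1 : ‖((l.2 : ℂ) + 1)‖ = (l.2 : ℝ) + 1 := by
        exact_mod_cast Complex.norm_natCast (l.2 + 1)
      simp only [aConst, aOrder, norm_div, norm_mul, norm_pow, Complex.norm_natCast,
        Complex.norm_real, h1, Real.norm_of_nonneg hν.le]
      field_simp
    have hp : (1 + δ) * ρ ≤ ((1 + δ) * ρ) ^ d := le_self_pow₀ hB (by omega)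
    have hrl := hr (U (l.2 + 1))
    have hρ₀ : 0 ≤ ρ := by linarith
    rw [hn]
    calc _ ≤ (α + 1) * ν * M * ((1 - x)⁻¹ * ((1 - x)⁻¹ * ((1 + δ) * ρ) ^ d)) := by
          gcongr
          exact (hu _).trans hp
      _ = _ := by ring
  have hP : ∀ p ∈ range (d + 1), ∀ t ∈ Finset.Nat.antidiagonalTuple (p + 1) j,
      ‖aConst ν (.inr ⟨p, t⟩)‖ *
      ((aOrder (.inr ⟨p, t⟩))! * ν ^ aOrder (.inr ⟨p, t⟩) * M) * ((1 - x)⁻¹ * ((1 - x)⁻¹ *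
        ∏ h ∈ range (α + 1 + 1), (ρ + r (U h)) ^ aExp (.inr ⟨p, t⟩) h)) ≤
      M * (1 - x)⁻¹ ^ 2 * ((1 + δ) * ρ) ^ d := by
    intro p hp t ht
    have hp' : p ≤ d := Nat.lt_succ_iff.mp (mem_range.mp hp)
    simp only [aExp]
    rw [prod_pow_card_fiber (fun l : Fin p => t l.succ)
      (fun l => by have := le_of_mem_antidiagonalTuple ht l.succ; omega) fun h => ρ + r (U h)]
    have hn : ‖aConst ν (.inr ⟨p, t⟩)‖ * ((aOrder (.inr ⟨p, t⟩))! * ν ^ aOrder (.inr ⟨p, t⟩) * M)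
        = M := by
      simp only [aConst, aOrder, norm_div, norm_mul, norm_pow, Complex.norm_natCast,
        Complex.norm_real, Real.norm_of_nonneg hν.le, norm_one]
      field_simp
    have hprod : ∏ l : Fin p, (ρ + r (U (t l.succ))) ≤ ((1 + δ) * ρ) ^ d := by
      calc _ ≤ ∏ _l : Fin p, ((1 + δ) * ρ) := prod_le_prod (fun _ _ => hu₀ _) fun _ _ => hu _
        _ = ((1 + δ) * ρ) ^ p := by simp
        _ ≤ _ := pow_le_pow_right₀ hB hp'
    rw [hn]
    calc _ ≤ M * ((1 - x)⁻¹ * ((1 - x)⁻¹ * ((1 + δ) * ρ) ^ d)) := by gcongr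
      _ = _ := by ring
  have hS₁ := sum_le_card_nsmul _ _ _ hA
  have hS₂ := sum_le_sum fun p hp => (sum_le_card_nsmul _ _ _ (hP p hp)).trans
    (show _ ≤ ((α : ℝ) + 1) ^ d * (M * (1 - x)⁻¹ ^ 2 * ((1 + δ) * ρ) ^ d) by
      rw [nsmul_eq_mul]
      gcongr
      have hp' : p ≤ d := Nat.lt_succ_iff.mp (mem_range.mp hp)
      calc (#(Finset.Nat.antidiagonalTuple (p + 1) j) : ℝ) ≤ ((j : ℝ) + 1) ^ p := by
            exact_mod_cast card_antidiagonalTuple_le p j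
        _ ≤ ((α : ℝ) + 1) ^ p := by gcongr
        _ ≤ _ := pow_le_pow_right₀ hα hp')
  refine (add_le_add hS₁ hS₂).trans ?_
  rw [Finset.Nat.card_antidiagonal, sum_const, card_range, nsmul_eq_mul, nsmul_eq_mul]
  -- The first sum grows like `(α+1)^2`; the assumption `d ≥ 2` lets the second sum dominate it.
  have hsq : ((j : ℝ) + 1) * (α + 1) ≤ ((α : ℝ) + 1) ^ d := by
    calc _ ≤ ((α : ℝ) + 1) ^ 2 := by nlinarith
      _ ≤ _ := pow_le_pow_right₀ hα hd
  push_cast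
  calc _ = (((j : ℝ) + 1) * (α + 1)) * (ν * M * (1 - x)⁻¹ ^ 2 * ((1 + δ) * ρ) ^ d) +
        ((d : ℝ) + 1) * (((α : ℝ) + 1) ^ d * (M * (1 - x)⁻¹ ^ 2 * ((1 + δ) * ρ) ^ d)) := by ring
    _ ≤ ((α : ℝ) + 1) ^ d * (ν * M * (1 - x)⁻¹ ^ 2 * ((1 + δ) * ρ) ^ d) +
        ((d : ℝ) + 1) * (((α : ℝ) + 1) ^ d * (M * (1 - x)⁻¹ ^ 2 * ((1 + δ) * ρ) ^ d)) := by gcongr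
    _ = _ := by rw [mul_pow]; ring

theorem wNorm_majorantSeries_funB_le (hs : R < s) (hs' : s < R') (hx : 0 ≤ x) (hx₁ : x < 1)
    (hν : 0 < ν) (hr : ∀ i, 0 < r i) (h₀ : r V0 ≤ x * (s - R))
    (h₁ : r V1 + 1 / ν ≤ x * (s - R)) (hδ : ∀ h, r (U h) ≤ δ) (hρ : 1 ≤ ρ) {j α : ℕ}
    (hj : j ≤ α) :
    wNorm (monom r) (majorantSeries R ρ (α + 1) (funB ν j)) ≤
      ENNReal.ofReal ((1 - x)⁻¹ ^ 2 * (1 + δ) * ν * ((α : ℝ) + 1) ^ 1 * ρ ^ 1) := by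
  have hδ₀ : 0 < δ := (hr (U 0)).trans_le (hδ 0)
  have hK : 0 < (1 - x)⁻¹ := inv_pos.mpr (by linarith)
  have hf : funB ν j = polyFn {()} (fun _ => ((j : ℂ) + 1) * (ν : ℂ))
      (fun _ t z => iteratedDeriv 0 ((fun _ _ => 1 : ℂ → ℂ → ℂ) t) z)
      (fun _ h => if h = j + 1 then 1 else 0) (α + 1 + 1) := by
    funext y
    rw [polyFn, sum_singleton, prod_pow_single (by omega) fun h => y (U h)]
    simp [funB]
  refine (wNorm_majorantSeries_le (hs.trans hs') hr (by linarith) hx hx₁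
    (M := fun _ => (0 ! : ℝ) * ν ^ 0 * 1)
    (fun _ _ => (sepHol_const R' R' 1).iteratedDeriv_right 0) (fun _ _ => by positivity)
    (fun _ _ => derivBound_iteratedDeriv (sepHol_const R' R' 1) hs hs' hx hx₁ hν (hr _).le
      (hr _).le h₀ h₁ zero_le_one (by simp) 0) fun y _ => congrFun hf y).trans
    (ENNReal.ofReal_le_ofReal ?_)
  rw [sum_singleton, prod_pow_single (by omega) fun h => ρ + r (U h)]
  have h1 : ‖((j : ℂ) + 1)‖ = (j : ℝ) + 1 := by
    exact_mod_cast Complex.norm_natCast (j + 1)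
  rw [norm_mul, h1, Complex.norm_real, Real.norm_of_nonneg hν.le]
  have hjα : ((j : ℝ) + 1) ≤ α + 1 := by gcongr
  have hu : ρ + r (U (j + 1)) ≤ (1 + δ) * ρ := by nlinarith [hδ (j + 1)]
  have hu₀ : 0 ≤ ρ + r (U (j + 1)) := by linarith [hr (U (j + 1))]
  calc _ = ((j : ℝ) + 1) * ν * ((1 - x)⁻¹ * ((1 - x)⁻¹ * (ρ + r (U (j + 1))))) := by simp
    _ ≤ ((α : ℝ) + 1) * ν * ((1 - x)⁻¹ * ((1 - x)⁻¹ * ((1 + δ) * ρ))) := by gcongr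
    _ = _ := by ring

end Majorants

/-! ### The majorants of the coefficients `B_{m,k}` -/

/-- Lagrange interpolation at `0, …, D`. It expresses the dependence on `u₀` through the values
`b(t,z,i,w)`, whose holomorphy and bounds are immediate, and so avoids a study of the polynomial
coefficients as functions of `t, z, w`. -/
theorem exists_eval_eq_sum_eval_natCast (D : ℕ) : ∃ c : ℕ → ℕ → ℂ, ∀ P : Polynomial ℂ,
    P.natDegree ≤ D → ∀ u : ℂ, P.eval u =
      ∑ i ∈ range (D + 1) ×ˢ range (D + 1), c i.1 i.2 * P.eval (i.1 : ℂ) * u ^ i.2 := by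
  have hinj : Set.InjOn (fun i : ℕ => (i : ℂ)) (range (D + 1) : Finset ℕ) :=
    Nat.cast_injective.injOn
  refine ⟨fun i m => (Lagrange.basis (range (D + 1)) (fun i : ℕ => (i : ℂ)) i).coeff m,
    fun P hP u => ?_⟩
  have hdeg : P.degree < #(range (D + 1)) := by
    rw [card_range]
    exact lt_of_le_of_lt Polynomial.degree_le_natDegree (by exact_mod_cast Nat.lt_succ_of_le hP)
  conv_lhs => rw [Lagrange.eq_interpolate hinj hdeg, Lagrange.interpolate_apply]
  rw [Polynomial.eval_finsetSum, sum_product]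
  refine sum_congr rfl fun i hi => ?_
  have hbasis : (Lagrange.basis (range (D + 1)) (fun i : ℕ => (i : ℂ)) i).natDegree < D + 1 := by
    rw [Lagrange.natDegree_basis hinj hi, card_range]
    omega
  rw [Polynomial.eval_mul, Polynomial.eval_C, Polynomial.eval_eq_sum_range' hbasis, mul_sum]
  exact sum_congr rfl fun m _ => by ring

section WCoeff

variable {R R' s w : ℝ} {b : ℂ → ℂ → ℂ → ℂ → ℂ}

theorem exists_norm_iteratedDeriv_zero_le (hw : 0 < w)
    (hb : DifferentiableOn ℂ (fun q : ℂ × ℂ × ℂ × ℂ => b q.1 q.2.1 q.2.2.1 q.2.2.2)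
      (Metric.ball 0 R' ×ˢ Metric.ball 0 R' ×ˢ Set.univ ×ˢ Metric.ball 0 w))
    {s₁ s₂ : ℝ} (hs₁ : s₁ < R') (hs₂ : s₂ < R') (D : ℕ) :
    ∃ M : ℝ, 0 ≤ M ∧ ∀ t z : ℂ, ‖t‖ ≤ s₁ → ‖z‖ ≤ s₂ → ∀ i ≤ D, ∀ β,
      ‖iteratedDeriv β (b t z i) 0‖ ≤ β ! * M / (w / 2) ^ β := by
  have hK : IsCompact (Metric.closedBall (0 : ℂ) s₁ ×ˢ Metric.closedBall (0 : ℂ) s₂ ×ˢ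
      Metric.closedBall (0 : ℂ) D ×ˢ Metric.closedBall (0 : ℂ) (w / 2)) :=
    (isCompact_closedBall _ _).prod ((isCompact_closedBall _ _).prod
      ((isCompact_closedBall _ _).prod (isCompact_closedBall _ _)))
  obtain ⟨M, hM⟩ := hK.exists_bound_of_continuousOn (hb.continuousOn.mono
    (Set.prod_mono (Metric.closedBall_subset_ball hs₁) (Set.prod_mono
      (Metric.closedBall_subset_ball hs₂) (Set.prod_mono (Set.subset_univ _)
        (Metric.closedBall_subset_ball (by linarith))))))
  refine ⟨max M 0, le_max_right _ _, fun t z ht hz i hi β => ?_⟩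
  refine norm_iteratedDeriv_le_of_bounded (s := w / 2) (R' := w) (by linarith)
    (hb.comp (f := fun y : ℂ => (t, z, (i : ℂ), y)) (by fun_prop) fun y hy =>
      ⟨by simpa using ht.trans_lt hs₁, by simpa using hz.trans_lt hs₂, Set.mem_univ _, hy⟩)
    (by linarith) (fun y hy => ?_) (by simp) β
  refine (hM (t, z, (i : ℂ), y) ⟨by simpa using ht, by simpa using hz, ?_, by simpa using hy⟩).trans
    (le_max_left _ _)
  simpa using hi

/-- With one of `t, z` frozen, this is the stability of `SepHol` under differentiation in the second
variable, applied to the pair formed with `w` and evaluated at `w = 0`. -/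
theorem sepHol_wCoeff (hw : 0 < w)
    (hb : DifferentiableOn ℂ (fun q : ℂ × ℂ × ℂ × ℂ => b q.1 q.2.1 q.2.2.1 q.2.2.2)
      (Metric.ball 0 R' ×ˢ Metric.ball 0 R' ×ˢ Set.univ ×ˢ Metric.ball 0 w)) (i β : ℕ) :
    SepHol R' R' fun t z => iteratedDeriv β (b t z i) 0 where
  left z hz := by
    have : SepHol R' w fun t y => b t z i y := sepHol_of_differentiableOn
      (hb.comp (f := fun q : ℂ × ℂ => (q.1, z, (i : ℂ), q.2)) (by fun_prop) fun q hq =>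
        ⟨hq.1, hz, Set.mem_univ _, hq.2⟩)
    exact (this.iteratedDeriv_right β).left 0 (Metric.mem_ball_self hw)
  right t ht := by
    have : SepHol R' w fun z y => b t z i y := sepHol_of_differentiableOn
      (hb.comp (f := fun q : ℂ × ℂ => (t, q.1, (i : ℂ), q.2)) (by fun_prop) fun q hq =>
        ⟨ht, hq.1, Set.mem_univ _, hq.2⟩)
    exact (this.iteratedDeriv_right β).left 0 (Metric.mem_ball_self hw)
  bdd s₁ hs₁ s₂ hs₂ := by
    obtain ⟨M, _, hM⟩ := exists_norm_iteratedDeriv_zero_le hw hb hs₁ hs₂ i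
    exact ⟨β ! * M / (w / 2) ^ β, fun t z ht hz => hM t z ht hz i le_rfl β⟩

theorem wCoeff_eqOn_polyFn (hw : 0 < w)
    (hb : DifferentiableOn ℂ (fun q : ℂ × ℂ × ℂ × ℂ => b q.1 q.2.1 q.2.2.1 q.2.2.2)
      (Metric.ball 0 R' ×ˢ Metric.ball 0 R' ×ˢ Set.univ ×ˢ Metric.ball 0 w)) {D : ℕ}
    (hpoly : ∀ t ∈ Metric.ball (0 : ℂ) R', ∀ z ∈ Metric.ball (0 : ℂ) R',
      ∀ y ∈ Metric.ball (0 : ℂ) w,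
        ∃ P : Polynomial ℂ, P.natDegree ≤ D ∧ ∀ u : ℂ, b t z u y = P.eval u)
    {c : ℕ → ℕ → ℂ} (hc : ∀ P : Polynomial ℂ, P.natDegree ≤ D → ∀ u : ℂ, P.eval u =
      ∑ i ∈ range (D + 1) ×ˢ range (D + 1), c i.1 i.2 * P.eval (i.1 : ℂ) * u ^ i.2) (β : ℕ) :
    Set.EqOn (wCoeff b β) (polyFn (range (D + 1) ×ˢ range (D + 1)) (fun i => c i.1 i.2)
      (fun i t z => iteratedDeriv β (b t z i.1) 0) (fun i _ => i.2) (0 + 1)) (vDomain R') := by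
  intro x hx
  have hx₀ : x V0 ∈ Metric.ball (0 : ℂ) R' := mem_ball_zero_iff.mpr hx.1
  have hx₁ : x V1 ∈ Metric.ball (0 : ℂ) R' := mem_ball_zero_iff.mpr hx.2
  have hev : (fun y => b (x V0) (x V1) (x (U 0)) y) =ᶠ[nhds 0] fun y =>
      ∑ i ∈ range (D + 1) ×ˢ range (D + 1),
        c i.1 i.2 * b (x V0) (x V1) i.1 y * x (U 0) ^ i.2 := by
    filter_upwards [Metric.isOpen_ball.mem_nhds (Metric.mem_ball_self hw)] with y hy
    obtain ⟨P, hP, hPb⟩ := hpoly _ hx₀ _ hx₁ y hy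
    simp only [hPb]
    exact hc P hP _
  have han : ∀ i : ℕ, ContDiffAt ℂ β (b (x V0) (x V1) i) 0 := fun i => by
    have : DifferentiableOn ℂ (b (x V0) (x V1) i) (Metric.ball 0 w) :=
      hb.comp (f := fun y : ℂ => (x V0, x V1, (i : ℂ), y)) (by fun_prop) fun y hy =>
        ⟨hx₀, hx₁, Set.mem_univ _, hy⟩
    exact (this.contDiffOn Metric.isOpen_ball).contDiffAt
      (Metric.isOpen_ball.mem_nhds (Metric.mem_ball_self hw))
  rw [wCoeff, hev.iteratedDeriv_eq, iteratedDeriv_fun_sum fun i _ =>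
    (contDiffAt_const.mul (han i.1)).mul contDiffAt_const]
  refine sum_congr rfl fun i _ => ?_
  rw [iteratedDeriv_mul_const_field, iteratedDeriv_const_mul_field]
  simp

theorem exists_tsum_wNorm_coeff_bigB_le {x δ : ℝ} {r : Var → ℝ} (hs : R < s) (hs' : s < R')
    (hx : 0 ≤ x) (hx₁ : x < 1) {ν : ℝ} (hν : 0 < ν) (hr : ∀ i, 0 < r i)
    (h₀ : r V0 ≤ x * (s - R)) (h₁ : r V1 + 1 / ν ≤ x * (s - R)) (hδ : r (U 0) ≤ δ) (hw : 0 < w)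
    (hb : DifferentiableOn ℂ (fun q : ℂ × ℂ × ℂ × ℂ => b q.1 q.2.1 q.2.2.1 q.2.2.2)
      (Metric.ball 0 R' ×ˢ Metric.ball 0 R' ×ˢ Set.univ ×ˢ Metric.ball 0 w)) {D : ℕ}
    (hpoly : ∀ t ∈ Metric.ball (0 : ℂ) R', ∀ z ∈ Metric.ball (0 : ℂ) R',
      ∀ y ∈ Metric.ball (0 : ℂ) w,
        ∃ P : Polynomial ℂ, P.natDegree ≤ D ∧ ∀ u : ℂ, b t z u y = P.eval u) :
    ∃ C : ℝ, 0 ≤ C ∧ ∀ ρ : ℝ, 1 ≤ ρ → ∀ W : ℝ, 0 ≤ W → W ≤ w / 4 →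
      ∑' β, ENNReal.ofReal (W ^ β) * wNorm (monom r) (PowerSeries.coeff β (bigB R ρ b)) ≤
        ENNReal.ofReal (C * ρ ^ D) := by
  obtain ⟨c, hc⟩ := exists_eval_eq_sum_eval_natCast D
  obtain ⟨M, hM₀, hM⟩ := exists_norm_iteratedDeriv_zero_le hw hb hs' hs' D
  have hδ₀ : 0 < δ := (hr (U 0)).trans_le hδ
  have hK : 0 < (1 - x)⁻¹ := inv_pos.mpr (by linarith)
  set C : ℝ := (∑ i ∈ range (D + 1) ×ˢ range (D + 1), ‖c i.1 i.2‖) * M * (1 - x)⁻¹ ^ 2 *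
    (1 + δ) ^ D with hC
  have hC₀ : 0 ≤ C := by positivity
  refine ⟨C * 2, by positivity, fun ρ hρ W hW hWw => ?_⟩
  have hB : (1 : ℝ) ≤ (1 + δ) * ρ := by nlinarith
  have hmaj : ∀ β, wNorm (monom r) (majorantSeries R ρ 0 (wCoeff b β)) ≤
      ENNReal.ofReal (β ! * (C * ρ ^ D / (w / 2) ^ β)) := by
    intro β
    refine (wNorm_majorantSeries_le (hs.trans hs') hr (by linarith) hx hx₁
      (s := range (D + 1) ×ˢ range (D + 1)) (a := fun i => c i.1 i.2) (e := fun i _ => i.2)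
      -- The trivial derivative of order `0` brings the coefficients into the form of
      -- `derivBound_iteratedDeriv` with `l = 0`.
      (c := fun i t z => iteratedDeriv 0 ((fun t z => iteratedDeriv β (b t z (i.1 : ℕ)) 0) t) z)
      (M := fun _ => (0 ! : ℝ) * ν ^ 0 * (β ! * M / (w / 2) ^ β))
      (fun i _ => (sepHol_wCoeff hw hb i.1 β).iteratedDeriv_right 0)
      (fun i _ => by positivity)
      (fun i hi => derivBound_iteratedDeriv (sepHol_wCoeff hw hb i.1 β) hs hs' hx hx₁ hν (hr _).le
        (hr _).le h₀ h₁ (by positivity) (fun t z ht hz => hM t z ht hz i.1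
          (Nat.lt_succ_iff.mp (mem_range.mp (mem_product.mp hi).1)) β) 0)
      (by simpa only [iteratedDeriv_zero] using wCoeff_eqOn_polyFn hw hb hpoly hc β)).trans (ENNReal.ofReal_le_ofReal ?_)
    have hterm : ∀ i ∈ range (D + 1) ×ˢ range (D + 1), ‖c i.1 i.2‖ *
        ((0 ! : ℝ) * ν ^ 0 * (β ! * M / (w / 2) ^ β)) *
        ((1 - x)⁻¹ * ((1 - x)⁻¹ * ∏ h ∈ range (0 + 1), (ρ + r (U h)) ^ i.2)) ≤
        ‖c i.1 i.2‖ * ((β ! * M / (w / 2) ^ β) * ((1 - x)⁻¹ ^ 2 * ((1 + δ) * ρ) ^ D)) := by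
      intro i hi
      have hi₂ : i.2 ≤ D := Nat.lt_succ_iff.mp (mem_range.mp (mem_product.mp hi).2)
      have hρ₀ : 0 ≤ ρ := by linarith
      have hr₀ := hr (U 0)
      have hpow : (ρ + r (U 0)) ^ i.2 ≤ ((1 + δ) * ρ) ^ D :=
        (pow_le_pow_left₀ (by positivity) (by nlinarith) _).trans (pow_le_pow_right₀ hB hi₂)
      simp only [zero_add, prod_range_one, Nat.factorial_zero, Nat.cast_one, pow_zero, one_mul]
      calc _ = ‖c i.1 i.2‖ * ((β ! * M / (w / 2) ^ β) * ((1 - x)⁻¹ ^ 2 * (ρ + r (U 0)) ^ i.2)) := by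
            ring
        _ ≤ _ := by gcongr
    refine (sum_le_sum hterm).trans (le_of_eq ?_)
    rw [← sum_mul, hC, mul_pow]
    ring
  have hcoeff : ∀ β, ENNReal.ofReal (W ^ β) *
      wNorm (monom r) (PowerSeries.coeff β (bigB R ρ b)) ≤
      ENNReal.ofReal (C * ρ ^ D) * 2⁻¹ ^ β := by
    intro β
    rw [bigB, PowerSeries.coeff_mk, wNorm_smul]
    have hn : ‖((β ! : ℂ)⁻¹)‖ₑ = ENNReal.ofReal ((β ! : ℝ)⁻¹) := by
      rw [← ofReal_norm, norm_inv, Complex.norm_natCast]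
    have h2 : (2⁻¹ : ℝ≥0∞) = ENNReal.ofReal 2⁻¹ := by
      rw [ENNReal.ofReal_inv_of_pos two_pos, ENNReal.ofReal_ofNat]
    rw [hn, h2, ← ENNReal.ofReal_pow (by positivity), ← ENNReal.ofReal_mul (by positivity)]
    refine (mul_le_mul_right (mul_le_mul_right (hmaj β) _) _).trans ?_
    rw [← ENNReal.ofReal_mul (by positivity), ← ENNReal.ofReal_mul (by positivity)]
    refine ENNReal.ofReal_le_ofReal ?_
    -- Cauchy's inequality was used on radius `w / 2`, so `W ≤ w / 4` gives a geometric series of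
    -- ratio `1/2`.
    have hWβ : W ^ β / (w / 2) ^ β ≤ 2⁻¹ ^ β := by
      rw [← div_pow]
      refine pow_le_pow_left₀ (by positivity) ?_ β
      rw [div_le_iff₀ (by positivity)]
      linarith
    have hfac : (0 : ℝ) < β ! := by positivity
    calc _ = C * ρ ^ D * (W ^ β / (w / 2) ^ β) := by field_simp
      _ ≤ _ := by gcongr
  refine (ENNReal.tsum_le_tsum hcoeff).trans (le_of_eq ?_)
  rw [ENNReal.tsum_mul_left, ENNReal.tsum_geometric, ENNReal.one_sub_inv_two, inv_inv,
    mul_right_comm C 2, ENNReal.ofReal_mul (p := C * ρ ^ D) (by positivity), ENNReal.ofReal_ofNat]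

end WCoeff

/-! ### Operators of norm `O(W)`, uniformly in `ρ` -/

/-- Operators depending on `ρ` whose norm is at most `C W` for all `ρ > 1` and `W ≤ min 1 w`. -/
def SmallOp (σ b w : ℝ) (r : Var → ℝ)
    (T : ℝ → PowerSeries (MvPowerSeries Var ℂ) → PowerSeries (MvPowerSeries Var ℂ)) : Prop :=
  ∃ C : ℝ, 0 ≤ C ∧ ∀ ρ : ℝ, 1 ≤ ρ → ∀ W : ℝ, 0 < W → W ≤ 1 → W ≤ w → ∀ Φ,
    wNormW (wt σ b ρ W r 0) (T ρ Φ) ≤ ENNReal.ofReal (C * W) * wNormW (wt σ b ρ W r 0) Φ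

section SmallOp

variable {σ b w : ℝ} {r : Var → ℝ}

theorem SmallOp.add
    {T T' : ℝ → PowerSeries (MvPowerSeries Var ℂ) → PowerSeries (MvPowerSeries Var ℂ)}
    (hT : SmallOp σ b w r T) (hT' : SmallOp σ b w r T') :
    SmallOp σ b w r fun ρ Φ => T ρ Φ + T' ρ Φ := by
  obtain ⟨C, hC, h⟩ := hT
  obtain ⟨C', hC', h'⟩ := hT'
  refine ⟨C + C', add_nonneg hC hC', fun ρ hρ W hW hW₁ hWw Φ => ?_⟩
  refine (wNormW_add_le _ _ _).trans
    ((add_le_add (h ρ hρ W hW hW₁ hWw Φ) (h' ρ hρ W hW hW₁ hWw Φ)).trans (le_of_eq ?_))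
  rw [add_mul C, ENNReal.ofReal_add (by positivity) (by positivity), add_mul]

theorem SmallOp.sum {ι : Type*} (s : Finset ι)
    {T : ι → ℝ → PowerSeries (MvPowerSeries Var ℂ) → PowerSeries (MvPowerSeries Var ℂ)}
    (hT : ∀ i ∈ s, SmallOp σ b w r (T i)) :
    SmallOp σ b w r fun ρ Φ => ∑ i ∈ s, T i ρ Φ := by
  classical
  induction s using Finset.induction_on with
  | empty =>
    exact ⟨0, le_rfl, fun ρ _ W _ _ _ Φ => by simp [wNormW_zero]⟩
  | insert i s hi ih =>
    simp_rw [sum_insert hi]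
    exact (hT i (mem_insert_self _ _)).add (ih fun j hj => hT j (mem_insert_of_mem hj))

/-- The estimate satisfied by the coefficients `B_{m,k}`: their norm is `O(ρ^D)`. -/
def GrowthBound (R w : ℝ) (r : Var → ℝ) (D : ℕ) (β : ℂ → ℂ → ℂ → ℂ → ℂ) : Prop :=
  ∃ K : ℝ, 0 ≤ K ∧ ∀ ρ : ℝ, 1 ≤ ρ → ∀ W : ℝ, 0 ≤ W → W ≤ w →
    ∑' n, ENNReal.ofReal (W ^ n) * wNorm (monom r) (PowerSeries.coeff n (bigB R ρ β)) ≤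
      ENNReal.ofReal (K * ρ ^ D)

theorem smallOp_mul_intW_iterate (hr : ∀ i, 0 < r i) (hσ : 0 < σ) (hb : 0 < b) {R : ℝ} {s : ℕ}
    (hs : 1 ≤ s) {D q t : ℕ} {A E : ℝ} (hA : 0 ≤ A) {β : ℂ → ℂ → ℂ → ℂ → ℂ}
    (hβ : GrowthBound R w r D β)
    {X : ℝ → PowerSeries (MvPowerSeries Var ℂ) → PowerSeries (MvPowerSeries Var ℂ)}
    (hX : ∀ ρ : ℝ, 1 ≤ ρ → ∀ W : ℝ, 0 < W → ∀ Φ α,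
      wNorm (wt σ b ρ W r s α) (PowerSeries.coeff α (X ρ Φ)) ≤
        ENNReal.ofReal (A * ((α : ℝ) + 1) ^ E * ρ ^ q * gain σ b ρ W s t α) *
          wNorm (wt σ b ρ W r 0 α) (PowerSeries.coeff α Φ))
    (hE : E + b * (D + q : ℕ) ≤ t) :
    SmallOp σ b w r fun ρ Φ => bigB R ρ β * intW^[s] (X ρ Φ) := by
  obtain ⟨K, hK, h⟩ := hβ
  refine ⟨K * A * (((D + q)! : ℝ) / σ ^ (D + q) * 2 ^ (b * (D + q : ℕ))), by positivity,
    fun ρ hρ W hW hW₁ hWw Φ => ?_⟩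
  exact wNormW_mul_intW_iterate_le hr hW hW₁ hσ hb (by linarith) hs hK hA
    (h ρ hρ W hW.le hWw) (hX ρ hρ W hW Φ) hE

theorem smallOp_dVar (hr : ∀ i, 0 < r i) (hσ : 0 < σ) (hb : 0 < b) {R : ℝ} {s : ℕ} (hs : 1 ≤ s)
    {D : ℕ} {β : ℂ → ℂ → ℂ → ℂ → ℂ} (hβ : GrowthBound R w r D β) (i : Var)
    (hD : b * D ≤ (s : ℝ) - 1) :
    SmallOp σ b w r fun ρ Φ => bigB R ρ β * intW^[s] (dVar i Φ) := by
  refine smallOp_mul_intW_iterate hr hσ hb hs (A := (r i)⁻¹) (E := 0) (q := 0) (t := s - 1)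
    (inv_nonneg.mpr (hr i).le) hβ (fun ρ hρ W hW Φ α => ?_) ?_
  · rw [coeff_dVar, Real.rpow_zero, pow_zero, mul_one, mul_one]
    exact wNorm_dVar_le hr hW hσ.le (by linarith) hs i α _
  · rw [Nat.cast_sub hs]
    simpa using hD

theorem smallOp_self (hr : ∀ i, 0 < r i) (hσ : 0 < σ) (hb : 0 < b) {R : ℝ} {s : ℕ} (hs : 1 ≤ s)
    {D : ℕ} {β : ℂ → ℂ → ℂ → ℂ → ℂ} (hβ : GrowthBound R w r D β) (hD : b * D ≤ (s : ℝ)) :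
    SmallOp σ b w r fun ρ Φ => bigB R ρ β * intW^[s] Φ := by
  refine smallOp_mul_intW_iterate hr hσ hb hs (A := 1) (E := 0) (q := 0) (t := s) (X := fun _ Φ => Φ)
    zero_le_one hβ (fun ρ hρ W hW Φ α => ?_) (by simpa using hD)
  rw [Real.rpow_zero, pow_zero, mul_one, mul_one, one_mul]
  exact wNorm_mono_smul (gain_nonneg hW.le _ _ _)
    (wt_le_gain hr hW hσ.le (by linarith) hs α) _

theorem smallOp_opD (hr : ∀ i, 0 < r i) (hσ : 0 < σ) (hb : 0 < b) {R δ : ℝ} (hδ : 0 < δ)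
    (hrU : ∀ h, r (U h) = δ / ((h : ℝ) ^ b + 1)) {s : ℕ} (hs : 1 ≤ s)
    {D p q : ℕ} {β : ℂ → ℂ → ℂ → ℂ → ℂ} (hβ : GrowthBound R w r D β)
    {F : ℕ → (Var → ℂ) → ℂ} {A : ℝ} (hA : 0 ≤ A)
    (hF : ∀ ρ : ℝ, 1 ≤ ρ → ∀ α, ∀ j ≤ α, wNorm (monom r) (majorantSeries R ρ (α + 1) (F j)) ≤
      ENNReal.ofReal (A * ((α : ℝ) + 1) ^ p * ρ ^ q))
    (hD : 1 + p + b + b * (D + q : ℕ) ≤ (s : ℝ) - 1) :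
    SmallOp σ b w r fun ρ Φ => bigB R ρ β * intW^[s] (opD R ρ F Φ) := by
  -- The exponent `1 + p + b` collects the number of values of `j`, the growth of the majorants, and
  -- the growth of `1/Ū_j`.
  refine smallOp_mul_intW_iterate hr hσ hb hs (A := A * (2 / δ)) (E := 1 + p + b) (q := q)
    (t := s - 1) (by positivity) hβ (fun ρ hρ W hW Φ α => ?_) ?_
  · have hα : (1 : ℝ) ≤ (α : ℝ) + 1 := by linarith [(Nat.cast_nonneg α : (0 : ℝ) ≤ α)]
    have hinv : ∀ j ≤ α, (r (U j))⁻¹ ≤ 2 / δ * ((α : ℝ) + 1) ^ b := by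
      intro j hj
      have h₁ : (j : ℝ) ^ b ≤ ((α : ℝ) + 1) ^ b := by
        have : (j : ℝ) ≤ α := by exact_mod_cast hj
        exact Real.rpow_le_rpow (by positivity) (by linarith) hb.le
      have h₂ : (1 : ℝ) ≤ ((α : ℝ) + 1) ^ b := Real.one_le_rpow hα hb.le
      rw [hrU, inv_div, div_mul_eq_mul_div]
      gcongr
      linarith
    refine (wNorm_coeff_opD_le hr hW hσ.le (by linarith) hs R F α (by positivity)
      (hF ρ hρ α) hinv Φ).trans (le_of_eq ?_)
    rw [Real.rpow_add (by positivity), Real.rpow_add (by positivity), Real.rpow_one,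
      Real.rpow_natCast]
    congr 2
    ring
  · rw [Nat.cast_sub hs, Nat.cast_one]
    exact hD

end SmallOp

/-! ### The linear operator of the functional equation -/

/-- The linear operator on the right-hand side of the functional equation. -/
def stepOp (R ρ : ℝ) (𝒮 : Finset ℕ) (S : ℕ) (bf : ℕ → ℕ → ℂ → ℂ → ℂ → ℂ → ℂ)
    (FA FB : ℕ → (Var → ℂ) → ℂ) :
    PowerSeries (MvPowerSeries Var ℂ) →+ PowerSeries (MvPowerSeries Var ℂ) :=
  AddMonoidHom.mk' (fun Φ =>
    (∑ k ∈ 𝒮, (bigB R ρ (bf 1 k) * intW^[S - k] (dVar V0 Φ)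
      + bigB R ρ (bf 1 k) * intW^[S - k] (opD R ρ FA Φ)))
    + (∑ k ∈ 𝒮, (bigB R ρ (bf 2 k) * intW^[S - k] (dVar V1 Φ)
      + bigB R ρ (bf 2 k) * intW^[S - k] (opD R ρ FB Φ)))
    + ∑ k ∈ 𝒮, bigB R ρ (bf 3 k) * intW^[S - k] Φ) fun Φ Ψ => by
  simp only [dVar_add, opD_add, intW_iterate_add, mul_add, sum_add_distrib]
  abel

theorem coeff_stepOp_eq_zero {R ρ : ℝ} {𝒮 : Finset ℕ} {S : ℕ} (hSk : ∀ k ∈ 𝒮, k < S)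
    (bf : ℕ → ℕ → ℂ → ℂ → ℂ → ℂ → ℂ) (FA FB : ℕ → (Var → ℂ) → ℂ)
    {Φ : PowerSeries (MvPowerSeries Var ℂ)} {N : ℕ}
    (hΦ : ∀ α < N, PowerSeries.coeff α Φ = 0) :
    ∀ α < N + 1, PowerSeries.coeff α (stepOp R ρ 𝒮 S bf FA FB Φ) = 0 := by
  have hd : ∀ i, ∀ α < N, PowerSeries.coeff α (dVar i Φ) = 0 := fun i α hα => by
    rw [coeff_dVar, hΦ α hα, map_zero]
  have hD : ∀ F, ∀ α < N, PowerSeries.coeff α (opD R ρ F Φ) = 0 := fun F α hα => by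
    simp [coeff_opD, hΦ α hα]
  intro α hα
  have hs : ∀ k ∈ 𝒮, 1 ≤ S - k := fun k hk => by have := hSk k hk; omega
  simp only [stepOp, AddMonoidHom.mk'_apply, map_add, map_sum]
  rw [sum_eq_zero, sum_eq_zero, sum_eq_zero, add_zero, add_zero]
  · intro k hk
    exact coeff_mul_intW_iterate_eq_zero (hs k hk) hΦ α hα
  · intro k hk
    rw [coeff_mul_intW_iterate_eq_zero (hs k hk) (hd V1) α hα,
      coeff_mul_intW_iterate_eq_zero (hs k hk) (hD FB) α hα, add_zero]
  · intro k hk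
    rw [coeff_mul_intW_iterate_eq_zero (hs k hk) (hd V0) α hα,
      coeff_mul_intW_iterate_eq_zero (hs k hk) (hD FA) α hα, add_zero]

theorem stepOp_mem_formalG {R ρ : ℝ} {𝒮 : Finset ℕ} {S : ℕ} (hSk : ∀ k ∈ 𝒮, k < S)
    (bf : ℕ → ℕ → ℂ → ℂ → ℂ → ℂ → ℂ) (FA FB : ℕ → (Var → ℂ) → ℂ)
    {Φ : PowerSeries (MvPowerSeries Var ℂ)} (hΦ : Φ ∈ formalG) :
    stepOp R ρ 𝒮 S bf FA FB Φ ∈ formalG := by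
  have hs : ∀ k ∈ 𝒮, 1 ≤ S - k := fun k hk => by have := hSk k hk; omega
  have hself : ∀ s α, PowerSeries.coeff α Φ ∈ seriesIn (varsUpTo (α + s)) := fun s α =>
    seriesIn_mono (varsUpTo_mono (Nat.le_add_right α s)) (mem_formalG_iff.mp hΦ α)
  have hd : ∀ i s α, PowerSeries.coeff α (dVar i Φ) ∈ seriesIn (varsUpTo (α + s)) :=
    fun i s α => by
      rw [coeff_dVar]
      exact pderiv_mem_seriesIn i (hself s α)
  have hD : ∀ F, ∀ s, 1 ≤ s → ∀ α, PowerSeries.coeff α (opD R ρ F Φ) ∈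
      seriesIn (varsUpTo (α + s)) := fun F s hs α =>
    seriesIn_mono (varsUpTo_mono (by omega)) (coeff_opD_mem hΦ α)
  have hB := fun m k => coeff_bigB_mem R ρ (bf m k)
  exact add_mem_formalG (add_mem_formalG
    (sum_mem_formalG _ fun k hk => add_mem_formalG
      (mul_intW_iterate_mem_formalG (hB 1 k) (hd V0 _))
      (mul_intW_iterate_mem_formalG (hB 1 k) (hD FA _ (hs k hk))))
    (sum_mem_formalG _ fun k hk => add_mem_formalG
      (mul_intW_iterate_mem_formalG (hB 2 k) (hd V1 _))
      (mul_intW_iterate_mem_formalG (hB 2 k) (hD FB _ (hs k hk)))))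
    (sum_mem_formalG _ fun k _ => mul_intW_iterate_mem_formalG (hB 3 k) (hself _))

/-- Radii for Cauchy's estimates. -/
theorem exists_cauchy_radius {R R' V₀ V₁ ν : ℝ} (hV₀ : 0 < V₀) (hV₀R : R + V₀ < R')
    (hV₁R : R + V₁ < R') (hν : 1 / (R' - R - V₁) < ν) :
    0 < ν ∧ ∃ s x : ℝ, R < s ∧ s < R' ∧ 0 ≤ x ∧ x < 1 ∧ V₀ ≤ x * (s - R) ∧
      V₁ + 1 / ν ≤ x * (s - R) := by
  have hpos : 0 < R' - R - V₁ := by linarith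
  have hν₀ : 0 < ν := (one_div_pos.mpr hpos).trans hν
  have hν' : 1 / ν < R' - R - V₁ := (one_div_lt hpos hν₀).mp hν
  refine ⟨hν₀, ?_⟩
  obtain ⟨s, hs, hs'⟩ := exists_between (show R + max V₀ (V₁ + 1 / ν) < R' by
    rw [← lt_sub_iff_add_lt', max_lt_iff]
    constructor <;> linarith)
  have hm : 0 < max V₀ (V₁ + 1 / ν) := lt_max_of_lt_left hV₀
  have hsR : 0 < s - R := by linarith
  refine ⟨s, max V₀ (V₁ + 1 / ν) / (s - R), by linarith, hs', by positivity, ?_, ?_, ?_⟩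
  · rw [div_lt_one hsR]
    linarith
  · rw [div_mul_cancel₀ _ hsR.ne']
    exact le_max_left _ _
  · rw [div_mul_cancel₀ _ hsR.ne']
    exact le_max_right _ _

end InfVar
end

/-! ### The proposition -/

open InfVar in
theorem proposition10
    (R R' : ℝ) (hR : 0 < R) (hRR' : R < R')
    -- the holomorphic coefficients `a`, `a_0, …, a_d` of the first order equation
    (d : ℕ) (hd : 2 ≤ d) (a : ℂ → ℂ → ℂ) (ap : ℕ → ℂ → ℂ → ℂ)
    (ha : DifferentiableOn ℂ (fun q : ℂ × ℂ => a q.1 q.2)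
      (Metric.ball 0 R' ×ˢ Metric.ball 0 R'))
    (hap : ∀ p ≤ d, DifferentiableOn ℂ (fun q : ℂ × ℂ => ap p q.1 q.2)
      (Metric.ball 0 R' ×ˢ Metric.ball 0 R'))
    -- the finite set `𝒮`, the integer `S`, and the functions `b_{m,k}`, `m = 1, 2, 3`
    (𝒮 : Finset ℕ) (S : ℕ) (hS : 1 ≤ S) (hSk : ∀ k ∈ 𝒮, k < S)
    (bf : ℕ → ℕ → ℂ → ℂ → ℂ → ℂ → ℂ) (dg : ℕ → ℕ → ℕ) (w : ℝ) (hw : 0 < w)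
    (hbf : ∀ m ∈ Finset.Icc 1 3, ∀ k ∈ 𝒮,
      DifferentiableOn ℂ (fun q : ℂ × ℂ × ℂ × ℂ => bf m k q.1 q.2.1 q.2.2.1 q.2.2.2)
        (Metric.ball 0 R' ×ˢ Metric.ball 0 R' ×ˢ Set.univ ×ˢ Metric.ball 0 w))
    (hpoly : ∀ m ∈ Finset.Icc 1 3, ∀ k ∈ 𝒮,
      ∀ t ∈ Metric.ball (0 : ℂ) R', ∀ z ∈ Metric.ball (0 : ℂ) R', ∀ y ∈ Metric.ball (0 : ℂ) w,
        ∃ P : Polynomial ℂ, P.natDegree ≤ dg m k ∧ ∀ u : ℂ, bf m k t z u y = P.eval u)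
    -- the parameters of the norms
    (σ b : ℝ) (hσ : 0 < σ) (hb : 1 < b)
    (hshape₁ : ∀ k ∈ 𝒮, (k : ℝ) + 1 + max (b * ((dg 1 k : ℝ) + 2) + 3)
      ((d : ℝ) + 1 + b * ((d : ℝ) + (dg 1 k : ℝ) + 1)) ≤ (S : ℝ))
    (hshape₂ : ∀ k ∈ 𝒮, (k : ℝ) + 3 + b * (2 + (dg 2 k : ℝ)) ≤ (S : ℝ))
    (hshape₃ : ∀ k ∈ 𝒮, (k : ℝ) + 1 + b * max (dg 1 k : ℝ) (dg 2 k : ℝ) ≤ (S : ℝ))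
    (hshape₄ : ∀ k ∈ 𝒮, (k : ℝ) + b * (dg 3 k : ℝ) ≤ (S : ℝ))
    (V₀ V₁ δ : ℝ) (hV₀ : 0 < V₀) (hV₁ : 0 < V₁) (hδ : 0 < δ)
    -- the radii stay inside the domain of holomorphy, and `ν` is large enough
    (hV₀R : R + V₀ < R') (hV₁R : R + V₁ < R')
    (ν : ℝ) (hν : 1 / (R' - R - V₁) < ν) :
    ∃ W : ℝ, 0 < W ∧ ∀ ρ : ℝ, 1 < ρ → ∀ I ∈ spaceG ρ σ b V₀ V₁ δ W,
      ∃ Ψ ∈ spaceG ρ σ b V₀ V₁ δ W,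
        (∀ Φ ∈ spaceG ρ σ b V₀ V₁ δ W,
          (Φ = (∑ k ∈ 𝒮,
              (bigB R ρ (bf 1 k) * intW^[S - k] (dVar Var.V0 Φ)
              + bigB R ρ (bf 1 k) * intW^[S - k] (opD R ρ (funA ν d a ap) Φ)))
            + (∑ k ∈ 𝒮,
              (bigB R ρ (bf 2 k) * intW^[S - k] (dVar Var.V1 Φ)
              + bigB R ρ (bf 2 k) * intW^[S - k] (opD R ρ (funB ν) Φ)))
            + (∑ k ∈ 𝒮, bigB R ρ (bf 3 k) * intW^[S - k] Φ)
            + I) ↔ Φ = Ψ) ∧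
        gNorm ρ σ b V₀ V₁ δ W Ψ ≤ 2 * gNorm ρ σ b V₀ V₁ δ W I := by
  obtain ⟨hν₀, s, x, hs, hs', hx, hx₁, h₀, h₁⟩ := exists_cauchy_radius hV₀ hV₀R hV₁R hν
  have hb₀ : 0 < b := by linarith
  set r : Var → ℝ := radius b V₀ V₁ δ with hrdef
  have hr : ∀ i, 0 < r i := radius_pos hV₀ hV₁ hδ
  have hrδ : ∀ h, r (Var.U h) ≤ δ := fun h =>
    div_le_self hδ.le (by linarith [Real.rpow_nonneg (Nat.cast_nonneg h : (0 : ℝ) ≤ h) b])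
  have hgrowth : ∀ m ∈ Finset.Icc 1 3, ∀ k ∈ 𝒮, GrowthBound R (w / 4) r (dg m k) (bf m k) :=
    fun m hm k hk => exists_tsum_wNorm_coeff_bigB_le hs hs' hx hx₁ hν₀ hr h₀ h₁ (hrδ 0) hw
      (hbf m hm k hk) (hpoly m hm k hk)
  have ha' := sepHol_of_differentiableOn ha
  have hap' : ∀ p ≤ d, SepHol R' R' (ap p) := fun p hp => sepHol_of_differentiableOn (hap p hp)
  obtain ⟨M, hM₀, hM, hMp⟩ : ∃ M : ℝ, 0 ≤ M ∧ (∀ t z, ‖t‖ ≤ s → ‖z‖ ≤ s → ‖a t z‖ ≤ M) ∧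
      ∀ p ≤ d, ∀ t z, ‖t‖ ≤ s → ‖z‖ ≤ s → ‖ap p t z‖ ≤ M := by
    obtain ⟨M₁, hM₁⟩ := ha'.bdd s hs' s hs'
    choose! M₂ hM₂ using fun p hp => (hap' p hp).bdd s hs' s hs'
    have hnn : 0 ≤ ∑ p ∈ Finset.range (d + 1), |M₂ p| := Finset.sum_nonneg fun _ _ => abs_nonneg _
    refine ⟨|M₁| + ∑ p ∈ Finset.range (d + 1), |M₂ p|, by positivity, fun t z ht hz => ?_,
      fun p hp t z ht hz => ?_⟩
    · linarith [hM₁ t z ht hz, le_abs_self M₁]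
    · have := Finset.single_le_sum (f := fun p => |M₂ p|) (fun _ _ => abs_nonneg _)
        (Finset.mem_range.mpr (Nat.lt_succ_of_le hp))
      linarith [hM₂ p hp t z ht hz, le_abs_self (M₂ p), abs_nonneg M₁]
  have hx' : 0 ≤ (1 - x)⁻¹ := inv_nonneg.mpr (by linarith)
  have hsk : ∀ k ∈ 𝒮, 1 ≤ S - k := fun k hk => by have := hSk k hk; omega
  have hcast : ∀ k ∈ 𝒮, ((S - k : ℕ) : ℝ) = (S : ℝ) - k := fun k hk => Nat.cast_sub (hSk k hk).le
  have hsmall : SmallOp σ b (w / 4) r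
      fun ρ Φ => stepOp R ρ 𝒮 S bf (funA ν d a ap) (funB ν) Φ := by
    refine ((SmallOp.sum 𝒮 fun k hk => ?_).add (SmallOp.sum 𝒮 fun k hk => ?_)).add
      (SmallOp.sum 𝒮 fun k hk => ?_)
    · refine (smallOp_dVar hr hσ hb₀ (hsk k hk) (hgrowth 1 (by simp) k hk) Var.V0 ?_).add
        (smallOp_opD hr hσ hb₀ hδ (fun h => rfl) (hsk k hk) (hgrowth 1 (by simp) k hk)
          (by positivity) (fun ρ hρ α j hj => wNorm_majorantSeries_funA_le hs hs' hx hx₁ hν₀ hr h₀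
            h₁ hrδ hρ hd ha' hap' hM₀ hM hMp hj) ?_)
      · rw [hcast k hk]
        have := hshape₃ k hk
        have := mul_le_mul_of_nonneg_left (le_max_left (dg 1 k : ℝ) (dg 2 k : ℝ)) hb₀.le
        linarith
      -- With `p = q = d` the requirement `1 + d + b + b (d_{1,k} + d) ≤ S - k - 1` is the second
      -- entry of the maximum in `hshape₁`.
      · rw [hcast k hk]
        have := hshape₁ k hk
        have := le_max_right (b * ((dg 1 k : ℝ) + 2) + 3)
          ((d : ℝ) + 1 + b * ((d : ℝ) + (dg 1 k : ℝ) + 1))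
        push_cast
        linarith
    · refine (smallOp_dVar hr hσ hb₀ (hsk k hk) (hgrowth 2 (by simp) k hk) Var.V1 ?_).add
        (smallOp_opD hr hσ hb₀ hδ (fun h => rfl) (hsk k hk) (hgrowth 2 (by simp) k hk)
          (by positivity) (fun ρ hρ α j hj => wNorm_majorantSeries_funB_le hs hs' hx hx₁ hν₀ hr h₀
            h₁ hrδ hρ hj) ?_)
      · rw [hcast k hk]
        have := hshape₃ k hk
        have := mul_le_mul_of_nonneg_left (le_max_right (dg 1 k : ℝ) (dg 2 k : ℝ)) hb₀.le
        linarith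
      -- With `p = q = 1` the requirement `2 + b + b (d_{2,k} + 1) ≤ S - k - 1` is `hshape₂`.
      · rw [hcast k hk]
        have := hshape₂ k hk
        push_cast
        linarith
    · refine smallOp_self hr hσ hb₀ (hsk k hk) (hgrowth 3 (by simp) k hk) ?_
      rw [hcast k hk]
      have := hshape₄ k hk
      linarith
  obtain ⟨C, hC, hT⟩ := hsmall
  -- The three entries serve `W^s ≤ W`, the convergence of the `B_{m,k}`, and `C W ≤ 1/2`; the
  -- denominator `C + 1` covers `C = 0`. None involves `ρ`.
  have hW : 0 < min 1 (min (w / 4) (2⁻¹ / (C + 1))) :=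
    lt_min one_pos (lt_min (by linarith) (by positivity))
  refine ⟨min 1 (min (w / 4) (2⁻¹ / (C + 1))), hW, fun ρ hρ I hI => ?_⟩
  refine existsUnique_spaceG hV₀ hV₁ hδ hW (stepOp R ρ 𝒮 S bf (funA ν d a ap) (funB ν))
    (fun Φ N hΦ => coeff_stepOp_eq_zero hSk bf _ _ hΦ)
    (fun Φ hΦ => stepOp_mem_formalG hSk bf _ _ hΦ) (fun Φ => ?_) hI
  refine (hT ρ hρ.le _ hW (min_le_left _ _) ((min_le_right _ _).trans (min_le_left _ _)) Φ).trans ?_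
  have h2 : (2⁻¹ : ENNReal) = ENNReal.ofReal 2⁻¹ := by
    rw [ENNReal.ofReal_inv_of_pos two_pos, ENNReal.ofReal_ofNat]
  rw [h2]
  gcongr
  calc _ ≤ (C + 1) * (2⁻¹ / (C + 1)) :=
        mul_le_mul (by linarith) ((min_le_right _ _).trans (min_le_right _ _)) hW.le (by linarith)
    _ = 2⁻¹ := mul_div_cancel₀ _ (by positivity)
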